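/- Let $K$ be an algebraically closed field (of arbitrary characteristic), let $Q=(Q_0,Q_1,t,h)$ be a quiver with finite vertex set and no directed cycles, let $KQ$ be its path algebra, $\mathfrak m\subset KQ$ the two-sided ideal generated by the arrows, and $I\subseteq\mathfrak m^2$ a two-sided ideal. Representations of $Q/I$ are left $KQ/I$-modules, $M_x=e_xM$ is the space at the vertex $x$, and $\operatorname{gldim} Q/I$ is the supremum of the projective dimensions of the left $KQ/I$-modules. The extension quiver $Q^e$ has vertex set $\{0,1\}\times Q_0$ and, for every arrow $a\colon x\to y$ of $Q$, three arrows $(0,x)\to(0,y)$, $(1,x)\to(0,y)$ and $(1,x)\to(1,y)$; let $a'\in KQ^e$ be their sum. The ideal $I^e\subseteq KQ^e$ is the two-sided ideal generated by the homogeneous components (the parts supported on paths from one given vertex to another) of the elements obtained from the elements of $I$ by replacing every arrow $a$ by $a'$ (and every trivial path $e_x$ by $e_{(0,x)}+e_{(1,x)}$). If $N\subseteq M$ are representations of $Q/I$ and $C_x$ is a vector space complement of $N_x$ in $M_x$ for every $x\in Q_0$, then the associated representation $M'=(N\subseteq M)$ of $Q^e/I^e$ has $M'_{(0,x)}=N_x$,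 $M'_{(1,x)}=C_x$, and the three arrows over $a\colon x\to y$ act by the blocks $N_x\to N_y$, $C_x\to N_y$, $C_x\to C_y$ of the map $a\colon N_x\oplus C_x\to N_y\oplus C_y$. Suppose that $\operatorname{gldim} Q/I\le 2$. Then: 1. $\operatorname{gldim} Q^e/I^e\le 2$. 2. For all representations $N\subseteq M$ of $Q/I$ and every choice of complements $C_x$: if $\operatorname{Ext}^2_{Q/I}(M/N,M/N)=0$ and $\operatorname{Ext}^2_{Q/I}(M,N)=0$, then $\operatorname{Ext}^2_{Q^e/I^e}(M',M')=0$. -/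

import Mathlib

open CategoryTheory

universe u v w t

/-! ### Path algebras -/

/-- A quiver has no directed cycles: every path from a vertex to itself is trivial. -/
def QuiverAcyclic (V : Type v) [Quiver.{w} V] : Prop :=
  ∀ (x : V) (p : Quiver.Path x x), p.length = 0

/-- The path algebra `K Q` of a quiver with vertex set `V`: finite linear combinations of paths. -/
def PathAlgebra (K : Type u) [Field K] (V : Type v) [Quiver.{w} V] : Type (max u v w) :=
  (Σ x y : V, Quiver.Path x y) →₀ K

namespace PathAlgebra

section Basic

variable (K : Type u) [Field K] (V : Type v) [Quiver.{w} V]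

noncomputable instance : AddCommGroup (PathAlgebra K V) :=
  inferInstanceAs (AddCommGroup ((Σ x y : V, Quiver.Path x y) →₀ K))

noncomputable instance : Module K (PathAlgebra K V) :=
  inferInstanceAs (Module K ((Σ x y : V, Quiver.Path x y) →₀ K))

variable {V}

/-- A path, viewed as an element of the path algebra. -/
noncomputable def ofPath {x y : V} (p : Quiver.Path x y) : PathAlgebra K V :=
  Finsupp.single (⟨x, y, p⟩ : Σ x y : V, Quiver.Path x y) (1 : K)

/-- The trivial path at a vertex. -/
noncomputable def idem (x : V) : PathAlgebra K V := ofPath K (Quiver.Path.nil : Quiver.Path x x)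

/-- An arrow, viewed as an element of the path algebra. -/
noncomputable def ofArrow {x y : V} (a : x ⟶ y) : PathAlgebra K V := ofPath K a.toPath

/-- Linear maps out of the path algebra, given by their values on paths. -/
noncomputable def linLift {B : Type t} [AddCommGroup B] [Module K B]
    (F : ∀ ⦃x y : V⦄, Quiver.Path x y → B) : PathAlgebra K V →ₗ[K] B :=
  Finsupp.lift B K (Σ x y : V, Quiver.Path x y) (fun s => F s.2.2)

@[simp] lemma linLift_ofPath {B : Type t} [AddCommGroup B] [Module K B]
    (F : ∀ ⦃x y : V⦄, Quiver.Path x y → B) {x y : V} (p : Quiver.Path x y) :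
    linLift K F (ofPath K p) = F p := by
  change Finsupp.lift B K (Σ x y : V, Quiver.Path x y) (fun s => F s.2.2)
    (Finsupp.single ⟨x, y, p⟩ 1) = F p
  simp

lemma lin_ext {B : Type t} [AddCommGroup B] [Module K B] {f g : PathAlgebra K V →ₗ[K] B}
    (h : ∀ (x y : V) (p : Quiver.Path x y), f (ofPath K p) = g (ofPath K p)) : f = g := by
  refine Finsupp.lhom_ext' fun s => LinearMap.ext_ring ?_
  exact h s.1 s.2.1 s.2.2

open Classical in
/-- The product `q p` of two paths: first `p`, then `q`, and `0` if they do not compose. -/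
noncomputable def pathMul {z y' x y : V} (q : Quiver.Path z y') (p : Quiver.Path x y) :
    PathAlgebra K V :=
  if h : z = y then ofPath K (p.comp (q.cast h rfl)) else 0

/-- The bilinear extension of the product of paths. -/
noncomputable def mulLin : PathAlgebra K V →ₗ[K] PathAlgebra K V →ₗ[K] PathAlgebra K V :=
  linLift K fun _ _ q => linLift K fun _ _ p => pathMul K q p

noncomputable instance : Mul (PathAlgebra K V) := ⟨fun f g => mulLin K f g⟩

lemma mul_def (f g : PathAlgebra K V) : f * g = mulLin K f g := rfl

lemma ofPath_mul_ofPath {x y z : V} (q : Quiver.Path y z) (p : Quiver.Path x y) :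
    ofPath K q * ofPath K p = ofPath K (p.comp q) := by
  simp [mul_def, mulLin, pathMul]

lemma ofPath_mul_ofPath_of_ne {x y y' z : V} (q : Quiver.Path y' z) (p : Quiver.Path x y)
    (h : y' ≠ y) : ofPath K q * ofPath K p = 0 := by
  simp [mul_def, mulLin, pathMul, h]

lemma idem_mul_idem (x : V) : idem K x * idem K x = idem K x :=
  ofPath_mul_ofPath K _ _

lemma idem_mul_idem_of_ne {x y : V} (h : x ≠ y) : idem K x * idem K y = 0 :=
  ofPath_mul_ofPath_of_ne K _ _ h

lemma idem_mul_ofArrow {x y : V} (a : x ⟶ y) : idem K y * ofArrow K a = ofArrow K a :=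
  ofPath_mul_ofPath K _ _

lemma ofArrow_mul_idem {x y : V} (a : x ⟶ y) : ofArrow K a * idem K x = ofArrow K a :=
  (ofPath_mul_ofPath K _ _).trans (by rw [Quiver.Path.nil_comp]; rfl)

lemma ofPath_cons {x y z : V} (p : Quiver.Path x y) (a : y ⟶ z) :
    ofPath K (p.cons a) = ofArrow K a * ofPath K p :=
  (ofPath_mul_ofPath K a.toPath p).symm

lemma mul_zero_aux (f : PathAlgebra K V) : f * 0 = 0 := (mulLin K f).map_zero

lemma zero_mul_aux (f : PathAlgebra K V) : 0 * f = 0 := by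
  rw [mul_def, map_zero, LinearMap.zero_apply]

lemma mul_assoc_aux (f g h : PathAlgebra K V) : f * g * h = f * (g * h) := by
  have key : (mulLin K (V := V)).compr₂ (mulLin K) =
      (LinearMap.llcomp K (PathAlgebra K V) _ _ ∘ₗ mulLin K).compl₂ (mulLin K) := by
    refine lin_ext K fun y' z r => lin_ext K fun x' y q => lin_ext K fun v x p => ?_
    change ofPath K r * ofPath K q * ofPath K p = ofPath K r * (ofPath K q * ofPath K p)
    by_cases h₁ : y' = y
    · subst h₁
      by_cases h₂ : x' = x
      · subst h₂
        simp only [ofPath_mul_ofPath, Quiver.Path.comp_assoc]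
      · rw [ofPath_mul_ofPath_of_ne K q p h₂, ofPath_mul_ofPath,
          ofPath_mul_ofPath_of_ne K _ p h₂, mul_zero_aux]
    · rw [ofPath_mul_ofPath_of_ne K r q h₁, zero_mul_aux]
      by_cases h₂ : x' = x
      · subst h₂
        rw [ofPath_mul_ofPath, ofPath_mul_ofPath_of_ne K r _ h₁]
      · rw [ofPath_mul_ofPath_of_ne K q p h₂, mul_zero_aux]
  exact LinearMap.congr_fun (LinearMap.congr_fun (LinearMap.congr_fun key f) g) h

variable [Fintype V]

noncomputable instance : One (PathAlgebra K V) := ⟨∑ x : V, idem K x⟩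

lemma one_def : (1 : PathAlgebra K V) = ∑ x : V, idem K x := rfl

lemma one_mul_aux (f : PathAlgebra K V) : 1 * f = f := by
  have h : mulLin K (1 : PathAlgebra K V) = LinearMap.id := by
    refine lin_ext K fun x y p => ?_
    rw [one_def, map_sum, LinearMap.sum_apply, Finset.sum_eq_single y]
    · exact ofPath_mul_ofPath K Quiver.Path.nil p
    · intro z _ hz
      exact ofPath_mul_ofPath_of_ne K _ p hz
    · simp
  exact LinearMap.congr_fun h f

lemma mul_one_aux (f : PathAlgebra K V) : f * 1 = f := by
  have h : (mulLin K).flip (1 : PathAlgebra K V) = LinearMap.id := by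
    refine lin_ext K fun x y p => ?_
    rw [one_def, map_sum, LinearMap.sum_apply, Finset.sum_eq_single x]
    · exact (ofPath_mul_ofPath K p Quiver.Path.nil).trans (by simp)
    · intro z _ hz
      exact ofPath_mul_ofPath_of_ne K p _ hz.symm
    · simp
  exact LinearMap.congr_fun h f

noncomputable instance : Ring (PathAlgebra K V) :=
  { (inferInstance : AddCommGroup (PathAlgebra K V)),
    (inferInstance : Mul (PathAlgebra K V)),
    (inferInstance : One (PathAlgebra K V)) with
    left_distrib := fun f g h => (mulLin K f).map_add g h
    right_distrib := fun f g h => by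
      simp only [mul_def]
      rw [map_add, LinearMap.add_apply]
    zero_mul := zero_mul_aux K
    mul_zero := mul_zero_aux K
    mul_assoc := mul_assoc_aux K
    one_mul := one_mul_aux K
    mul_one := mul_one_aux K }

noncomputable instance : Algebra K (PathAlgebra K V) :=
  Algebra.ofModule
    (fun c f g => by
      simp only [mul_def]
      rw [map_smul, LinearMap.smul_apply])
    (fun c f g => (mulLin K f).map_smul c g)

lemma sum_idem : ∑ x : V, idem K x = 1 := rfl

variable (V) in
/-- The two-sided ideal `𝔪` of the path algebra generated by all arrows. -/
noncomputable def arrowIdeal : Ideal (PathAlgebra K V) :=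
  (TwoSidedIdeal.span
    {z : PathAlgebra K V | ∃ (x y : V) (a : x ⟶ y), z = ofArrow K a}).asIdeal

/-! Algebra maps out of the path algebra are given by orthogonal idempotents with sum `1` and
elements attached to the arrows which are compatible with the idempotents. -/

/-- The value of a path, given values of the trivial paths and of the arrows. -/
def evalPath {B : Type t} [Ring B] (e : V → B) (f : ∀ ⦃x y : V⦄, (x ⟶ y) → B) {x : V} :
    ∀ {y : V}, Quiver.Path x y → B
  | _, .nil => e x
  | _, .cons p a => f a * evalPath e f p

/-- The algebra map with given values on the trivial paths and on the arrows. -/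
noncomputable def algLift {B : Type t} [Ring B] [Algebra K B]
    (e : V → B) (f : ∀ ⦃x y : V⦄, (x ⟶ y) → B)
    (he : ∀ x, e x * e x = e x) (hne : ∀ x y, x ≠ y → e x * e y = 0) (hsum : ∑ x, e x = 1)
    (hl : ∀ (x y : V) (a : x ⟶ y), e y * f a = f a)
    (_hr : ∀ (x y : V) (a : x ⟶ y), f a * e x = f a) : PathAlgebra K V →ₐ[K] B :=
  AlgHom.ofLinearMap (linLift K fun _ _ p => evalPath e f p)
    (by
      rw [one_def, map_sum, ← hsum]
      exact Finset.sum_congr rfl fun x _ => linLift_ofPath K _ _)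
    (by
      have hr' : ∀ {x y : V} (p : Quiver.Path x y), evalPath e f p * e x = evalPath e f p := by
        intro x y p
        induction p with
        | nil => exact he x
        | cons p a ih => rw [evalPath, mul_assoc, ih]
      have hl' : ∀ {x y : V} (p : Quiver.Path x y), e y * evalPath e f p = evalPath e f p := by
        intro x y p
        cases p with
        | nil => exact he x
        | cons p a => rw [evalPath, ← mul_assoc, hl]
      have hcomp : ∀ {x y z : V} (p : Quiver.Path x y) (q : Quiver.Path y z),
          evalPath e f (p.comp q) = evalPath e f q * evalPath e f p := by
        intro x y z p q
        induction q with
        | nil => exact (hl' p).symm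
        | cons q a ih => rw [Quiver.Path.comp_cons, evalPath, ih, evalPath, mul_assoc]
      set L : PathAlgebra K V →ₗ[K] B := linLift K fun _ _ p => evalPath e f p with hL
      have key : (mulLin K (V := V)).compr₂ L = (LinearMap.mul K B).compl₁₂ L L := by
        refine lin_ext K fun y' z q => lin_ext K fun x y p => ?_
        change L (ofPath K q * ofPath K p) = L (ofPath K q) * L (ofPath K p)
        by_cases h : y' = y
        · subst h
          rw [ofPath_mul_ofPath]
          simp only [hL, linLift_ofPath, hcomp]
        · rw [ofPath_mul_ofPath_of_ne K q p h, map_zero]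
          simp only [hL, linLift_ofPath]
          rw [← hr' q, ← hl' p, mul_assoc, ← mul_assoc (e y'), hne _ _ h, zero_mul, mul_zero]
      intro q p
      exact LinearMap.congr_fun (LinearMap.congr_fun key q) p)

section AlgLift

variable {B : Type t} [Ring B] [Algebra K B]
  (e : V → B) (f : ∀ ⦃x y : V⦄, (x ⟶ y) → B)
  (he : ∀ x, e x * e x = e x) (hne : ∀ x y, x ≠ y → e x * e y = 0) (hsum : ∑ x, e x = 1)
  (hl : ∀ (x y : V) (a : x ⟶ y), e y * f a = f a)
  (hr : ∀ (x y : V) (a : x ⟶ y), f a * e x = f a)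

lemma algLift_idem (x : V) : algLift K e f he hne hsum hl hr (idem K x) = e x :=
  linLift_ofPath K _ _

lemma algLift_ofArrow {x y : V} (a : x ⟶ y) :
    algLift K e f he hne hsum hl hr (ofArrow K a) = f a :=
  (linLift_ofPath K _ _).trans (hr x y a)

end AlgLift

lemma alg_ext {B : Type t} [Ring B] [Algebra K B] {φ ψ : PathAlgebra K V →ₐ[K] B}
    (h₀ : ∀ x : V, φ (idem K x) = ψ (idem K x))
    (h₁ : ∀ (x y : V) (a : x ⟶ y), φ (ofArrow K a) = ψ (ofArrow K a)) : φ = ψ := by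
  have : φ.toLinearMap = ψ.toLinearMap := by
    refine lin_ext K fun x y p => ?_
    change φ (ofPath K p) = ψ (ofPath K p)
    induction p with
    | nil => exact h₀ x
    | cons p a ih => rw [ofPath_cons, map_mul, map_mul, ih, h₁]
  exact AlgHom.toLinearMap_injective this

end Basic

end PathAlgebra

/-! ### The extension quiver -/

/-- The vertices `{0, 1} × Q₀` of the extension quiver. -/
@[ext]
structure ExtVertex (V : Type v) : Type v where
  /-- The first component of the vertex `(i, x)`. -/
  level : Fin 2
  /-- The second component of the vertex `(i, x)`. -/
  vertex : V

namespace ExtVertex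

/-- The vertices of the extension quiver as pairs. -/
def equivProd (V : Type v) : Fin 2 × V ≃ ExtVertex V where
  toFun s := ⟨s.1, s.2⟩
  invFun s := (s.level, s.vertex)
  left_inv _ := rfl
  right_inv _ := rfl

instance {V : Type v} [Fintype V] : Fintype (ExtVertex V) :=
  Fintype.ofEquiv (Fin 2 × V) (equivProd V)

lemma sum_eq {V : Type v} [Fintype V] {B : Type t} [AddCommMonoid B] (F : ExtVertex V → B) :
    ∑ s, F s = (∑ x, F ⟨0, x⟩) + ∑ x, F ⟨1, x⟩ := by
  rw [← (equivProd V).sum_comp F, Fintype.sum_prod_type, Fin.sum_univ_two]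
  rfl

/-- An arrow `(i, x) ⟶ (j, y)` of the extension quiver is an arrow `x ⟶ y` with `(i, j)` one of
`(0, 0)`, `(1, 0)`, `(1, 1)`. -/
instance {V : Type v} [Quiver.{w} V] : Quiver.{w} (ExtVertex V) where
  Hom s t := {_a : s.vertex ⟶ t.vertex // t.level ≤ s.level}

variable {V : Type v}

variable [Quiver.{w} V]

/-- The arrow `(i, x) ⟶ (j, y)` over an arrow `x ⟶ y`. -/
def arrow {i j : Fin 2} (h : j ≤ i) {x y : V} (a : x ⟶ y) : mk i x ⟶ mk j y := ⟨a, h⟩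

end ExtVertex

namespace PathAlgebra

section Ext

variable (K : Type u) [Field K] {V : Type v} [Quiver.{w} V]

/-- The element `e₍₀ₓ₎ + e₍₁ₓ₎` of the path algebra of the extension quiver. -/
noncomputable def extIdem (x : V) : PathAlgebra K (ExtVertex V) :=
  idem K (ExtVertex.mk 0 x) + idem K (ExtVertex.mk 1 x)

/-- The element `a'` of the path algebra of the extension quiver: the sum of the three arrows
`(0, x) ⟶ (0, y)`, `(1, x) ⟶ (0, y)` and `(1, x) ⟶ (1, y)` over the arrow `a`. -/
noncomputable def extArrow {x y : V} (a : x ⟶ y) : PathAlgebra K (ExtVertex V) :=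
  ofArrow K (ExtVertex.arrow (le_refl (0 : Fin 2)) a) +
    ofArrow K (ExtVertex.arrow (Fin.zero_le (1 : Fin 2)) a) +
    ofArrow K (ExtVertex.arrow (le_refl (1 : Fin 2)) a)

lemma idem_mk_mul (i j : Fin 2) (x y : V) (hxy : x ≠ y) :
    idem K (ExtVertex.mk i x) * idem K (ExtVertex.mk j y) = 0 :=
  idem_mul_idem_of_ne K fun h => hxy (congrArg ExtVertex.vertex h)

lemma idem_mk_mul' (i j : Fin 2) (x y : V) (hij : i ≠ j) :
    idem K (ExtVertex.mk i x) * idem K (ExtVertex.mk j y) = 0 :=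
  idem_mul_idem_of_ne K fun h => hij (congrArg ExtVertex.level h)

variable [Fintype V]

lemma idem_mk_mul_ofArrow {i j l : Fin 2} (h : j ≤ i) (hl : l ≠ j) {x y : V} (a : x ⟶ y) :
    idem K (ExtVertex.mk l y) * ofArrow K (ExtVertex.arrow h a) = 0 := by
  rw [← idem_mul_ofArrow, ← mul_assoc, idem_mk_mul' K l j y y hl, zero_mul]

lemma ofArrow_mul_idem_mk {i j l : Fin 2} (h : j ≤ i) (hl : i ≠ l) {x y : V} (a : x ⟶ y) :
    ofArrow K (ExtVertex.arrow h a) * idem K (ExtVertex.mk l x) = 0 := by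
  rw [← ofArrow_mul_idem, mul_assoc, idem_mk_mul' K i l x x hl, mul_zero]

/-- The algebra map `KQ → KQᵉ`, replacing every arrow `a` by `a'` (and every trivial path by
the sum of the two trivial paths above it). -/
noncomputable def extHom : PathAlgebra K V →ₐ[K] PathAlgebra K (ExtVertex V) :=
  algLift K (extIdem K) (fun _ _ a => extArrow K a)
    (by
      intro x
      simp only [extIdem, mul_add, add_mul, idem_mul_idem,
        idem_mk_mul' K 0 1 x x (by decide), idem_mk_mul' K 1 0 x x (by decide)]
      simp)
    (by
      intro x y h
      simp only [extIdem, mul_add, add_mul, idem_mk_mul K _ _ x y h, add_zero])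
    (by
      rw [← sum_idem, ExtVertex.sum_eq, ← Finset.sum_add_distrib]
      rfl)
    (by
      intro x y a
      have h (i j : Fin 2) (hij : j ≤ i) := idem_mul_ofArrow K (ExtVertex.arrow hij a)
      simp only [extIdem, extArrow, mul_add, add_mul, h,
        idem_mk_mul_ofArrow K _ (zero_ne_one (α := Fin 2)) a,
        idem_mk_mul_ofArrow K _ (one_ne_zero (α := Fin 2)) a, add_zero, zero_add])
    (by
      intro x y a
      have h (i j : Fin 2) (hij : j ≤ i) := ofArrow_mul_idem K (ExtVertex.arrow hij a)
      simp only [extIdem, extArrow, mul_add, add_mul, h,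
        ofArrow_mul_idem_mk K _ (zero_ne_one (α := Fin 2)) a,
        ofArrow_mul_idem_mk K _ (one_ne_zero (α := Fin 2)) a, add_zero, zero_add, add_assoc])

lemma extHom_idem (x : V) : extHom K (idem K x) = extIdem K x := algLift_idem K _ _ _ _ _ _ _ x

lemma extHom_ofArrow {x y : V} (a : x ⟶ y) : extHom K (ofArrow K a) = extArrow K a :=
  algLift_ofArrow K _ _ _ _ _ _ _ a

variable {K} in
/-- The ideal `Iᵉ` of relations of the extension quiver: the two-sided ideal generated by the
homogeneous components `e_t r' e_s` of the elements `r'`, where `r'` is obtained from a relation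
`r ∈ I` by replacing every arrow `a` by `a'`. -/
noncomputable def extIdeal (I : Ideal (PathAlgebra K V)) : Ideal (PathAlgebra K (ExtVertex V)) :=
  (TwoSidedIdeal.span
    {z | ∃ r ∈ I, ∃ s t : ExtVertex V, z = idem K t * extHom K r * idem K s}).asIdeal

variable {K} in
instance (I : Ideal (PathAlgebra K V)) : (extIdeal I).IsTwoSided :=
  inferInstanceAs (TwoSidedIdeal.asIdeal _).IsTwoSided

end Ext

end PathAlgebra

/-! ### Pairs `N ⊆ M` as representations of the extension quiver -/

section Pair

open PathAlgebra

variable {K : Type u} [Field K] {V : Type v} [Fintype V] [Quiver.{w} V]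
  {I : Ideal (PathAlgebra K V)} [I.IsTwoSided]
  {M : Type t} [AddCommGroup M] [Module K M] [Module (PathAlgebra K V ⧸ I) M]
  [IsScalarTower K (PathAlgebra K V ⧸ I) M]

/-- `C` is a choice, at every vertex `x`, of a vector space complement of `N_x` in `M_x`, where
`M_x = e_x M`: it is a linear complement of `N` in `M` which is stable under all `e_x`, i.e.
`C = ⨁ₓ C_x` with `C_x = e_x C` and `M_x = N_x ⊕ C_x`. -/
structure IsVertexwiseCompl (N : Submodule (PathAlgebra K V ⧸ I) M) (C : Submodule K M) :
    Prop where
  isCompl : IsCompl (N.restrictScalars K) C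
  idem_smul_mem : ∀ (x : V), ∀ m ∈ C, Ideal.Quotient.mk I (idem K x) • m ∈ C

variable (I M) in
/-- The action of the path algebra on a representation of `Q/I`. -/
noncomputable def pathAct : PathAlgebra K V →ₐ[K] Module.End K M :=
  (Algebra.lsmul K K M : (PathAlgebra K V ⧸ I) →ₐ[K] Module.End K M).comp (Ideal.Quotient.mkₐ K I)

lemma pathAct_apply (z : PathAlgebra K V) (m : M) :
    pathAct I M z m = Ideal.Quotient.mk I z • m := rfl

namespace IsVertexwiseCompl

variable {N : Submodule (PathAlgebra K V ⧸ I) M} {C : Submodule K M}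
  (h : IsVertexwiseCompl N C)

/-- The two projections of `M = N ⊕ C`: onto `N` for the index `0`, onto `C` for the index `1`. -/
noncomputable def proj (i : Fin 2) : Module.End K M :=
  if i = 0 then (N.restrictScalars K).projection C h.isCompl
  else C.projection (N.restrictScalars K) h.isCompl.symm

lemma proj_zero_mem (m : M) : h.proj 0 m ∈ N :=
  Submodule.projection_apply_mem (p := N.restrictScalars K) h.isCompl m

lemma proj_one_mem (m : M) : h.proj 1 m ∈ C :=
  Submodule.projection_apply_mem h.isCompl.symm m

lemma proj_zero_of_mem {m : M} (hm : m ∈ N) : h.proj 0 m = m :=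
  Submodule.projection_apply_of_mem_left (p := N.restrictScalars K) h.isCompl hm

lemma proj_one_of_mem {m : M} (hm : m ∈ C) : h.proj 1 m = m :=
  Submodule.projection_apply_of_mem_left h.isCompl.symm hm

lemma proj_add : h.proj 0 + h.proj 1 = 1 :=
  Submodule.projection_add_projection_eq_id h.isCompl

lemma proj_mul_self (i : Fin 2) : h.proj i * h.proj i = h.proj i := by
  ext m
  fin_cases i
  · exact h.proj_zero_of_mem (h.proj_zero_mem m)
  · exact h.proj_one_of_mem (h.proj_one_mem m)

lemma proj_mul_of_ne {i j : Fin 2} (hij : i ≠ j) : h.proj i * h.proj j = 0 := by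
  have h₀ : h.proj 1 = 1 - h.proj 0 := eq_sub_of_add_eq' h.proj_add
  have h₁ := h.proj_mul_self 0
  fin_cases i <;> fin_cases j
  · exact absurd rfl hij
  · change h.proj 0 * h.proj 1 = 0
    rw [h₀, mul_sub, mul_one, h₁, sub_self]
  · change h.proj 1 * h.proj 0 = 0
    rw [h₀, sub_mul, one_mul, h₁, sub_self]
  · exact absurd rfl hij

lemma proj_one_mul_act_mul_proj_zero (z : PathAlgebra K V) :
    h.proj 1 * pathAct I M z * h.proj 0 = 0 := by
  ext m
  have hm : pathAct I M z (h.proj 0 m) ∈ N := N.smul_mem _ (h.proj_zero_mem m)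
  change h.proj 1 (pathAct I M z (h.proj 0 m)) = 0
  rw [← h.proj_zero_of_mem hm]
  exact LinearMap.congr_fun (h.proj_mul_of_ne (one_ne_zero (α := Fin 2))) _

lemma proj_zero_mul_idem_mul_proj_one (x : V) :
    h.proj 0 * pathAct I M (idem K x) * h.proj 1 = 0 := by
  ext m
  have hm : pathAct I M (idem K x) (h.proj 1 m) ∈ C := h.idem_smul_mem x _ (h.proj_one_mem m)
  change h.proj 0 (pathAct I M (idem K x) (h.proj 1 m)) = 0
  rw [← h.proj_one_of_mem hm]
  exact LinearMap.congr_fun (h.proj_mul_of_ne (zero_ne_one (α := Fin 2))) _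

lemma act_idem_mul_proj (i : Fin 2) (x : V) :
    pathAct I M (idem K x) * h.proj i = h.proj i * pathAct I M (idem K x) := by
  set P := pathAct I M (idem K x) with hP
  have h₀ : h.proj 1 = 1 - h.proj 0 := eq_sub_of_add_eq' h.proj_add
  have h₁ : h.proj 1 * P * h.proj 0 = 0 := h.proj_one_mul_act_mul_proj_zero _
  have h₂ : h.proj 0 * P * h.proj 1 = 0 := h.proj_zero_mul_idem_mul_proj_one _
  rw [h₀] at h₁ h₂
  have h₃ : P * h.proj 0 = h.proj 0 * P := by
    rw [sub_mul, sub_mul, one_mul, sub_eq_zero] at h₁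
    rw [mul_sub, mul_one, sub_eq_zero] at h₂
    rw [h₁, ← h₂]
  fin_cases i
  · exact h₃
  · change P * h.proj 1 = h.proj 1 * P
    rw [h₀, mul_sub, sub_mul, h₃, one_mul, mul_one]

/-- The action of the path algebra of the extension quiver attached to `N ⊆ M` and the
decompositions `M_x = N_x ⊕ C_x`. The space at `(0, x)` is `N_x`, the space at `(1, x)` is `C_x`,
and the arrow `(i, x) ⟶ (j, y)` over `a : x ⟶ y` acts by the corresponding block of the map
`a : N_x ⊕ C_x → N_y ⊕ C_y` (whose block from `N_x` to `C_y` is zero). -/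
noncomputable def pairAct : PathAlgebra K (ExtVertex V) →ₐ[K] Module.End K M :=
  algLift K (fun s : ExtVertex V => h.proj s.level * pathAct I M (idem K s.vertex))
    (fun s t a => h.proj t.level * pathAct I M (ofArrow K a.1) * h.proj s.level)
    (by
      intro s
      rw [mul_assoc, ← mul_assoc (pathAct I M _), h.act_idem_mul_proj, mul_assoc, ← map_mul,
        idem_mul_idem, ← mul_assoc, h.proj_mul_self])
    (by
      intro s t hst
      rw [mul_assoc, ← mul_assoc (pathAct I M _), h.act_idem_mul_proj, mul_assoc, ← map_mul,
        ← mul_assoc]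
      by_cases h₁ : s.level = t.level
      · rw [idem_mul_idem_of_ne K (fun h₂ => hst (ExtVertex.ext h₁ h₂)), map_zero, mul_zero]
      · rw [h.proj_mul_of_ne h₁, zero_mul])
    (by
      rw [ExtVertex.sum_eq]
      simp only [← Finset.mul_sum]
      rw [← map_sum, sum_idem, map_one, mul_one, mul_one, h.proj_add])
    (by
      intro s t a
      rw [← mul_assoc, ← mul_assoc, mul_assoc (h.proj t.level) _ (h.proj t.level), h.act_idem_mul_proj,
        ← mul_assoc, h.proj_mul_self, mul_assoc (h.proj t.level), ← map_mul, idem_mul_ofArrow])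
    (by
      intro s t a
      rw [mul_assoc, ← mul_assoc (h.proj s.level), h.proj_mul_self, ← h.act_idem_mul_proj, ← mul_assoc,
        mul_assoc (h.proj t.level), ← map_mul, ofArrow_mul_idem])

lemma pairAct_idem (s : ExtVertex V) :
    h.pairAct (idem K s) = h.proj s.level * pathAct I M (idem K s.vertex) :=
  algLift_idem K _ _ _ _ _ _ _ s

lemma pairAct_ofArrow {s t : ExtVertex V} (a : s ⟶ t) :
    h.pairAct (ofArrow K a) = h.proj t.level * pathAct I M (ofArrow K a.1) * h.proj s.level :=
  algLift_ofArrow K _ _ _ _ _ _ _ a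

lemma pairAct_extHom (z : PathAlgebra K V) : h.pairAct (extHom K z) = pathAct I M z := by
  have key : h.pairAct.comp (extHom K) = pathAct I M := by
    refine alg_ext K (fun x => ?_) fun x y a => ?_
    · change h.pairAct (extHom K (idem K x)) = _
      rw [extHom_idem, extIdem, map_add, pairAct_idem, pairAct_idem]
      change h.proj 0 * _ + h.proj 1 * _ = _
      rw [← add_mul, h.proj_add, one_mul]
    · change h.pairAct (extHom K (ofArrow K a)) = _
      rw [extHom_ofArrow, extArrow, map_add, map_add, pairAct_ofArrow, pairAct_ofArrow,
        pairAct_ofArrow]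
      change h.proj 0 * pathAct I M (ofArrow K a) * h.proj 0 +
        h.proj 0 * pathAct I M (ofArrow K a) * h.proj 1 +
        h.proj 1 * pathAct I M (ofArrow K a) * h.proj 1 = pathAct I M (ofArrow K a)
      rw [← mul_add, h.proj_add, mul_one]
      have h₁ := h.proj_one_mul_act_mul_proj_zero (ofArrow K a)
      have h₀ : h.proj 0 = 1 - h.proj 1 := eq_sub_of_add_eq h.proj_add
      rw [h₀, mul_sub, mul_one, sub_eq_zero] at h₁
      rw [← h₁, ← add_mul, h.proj_add, one_mul]
  exact AlgHom.congr_fun key z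

lemma pairAct_eq_zero (z : PathAlgebra K (ExtVertex V)) (hz : z ∈ extIdeal I) :
    h.pairAct z = 0 := by
  have hle : TwoSidedIdeal.span
      {z | ∃ r ∈ I, ∃ s t : ExtVertex V, z = idem K t * extHom K r * idem K s} ≤
      TwoSidedIdeal.ker h.pairAct := by
    rw [TwoSidedIdeal.span_le]
    rintro _ ⟨r, hr, s, t, rfl⟩
    have h₁ : pathAct I M r = 0 := by
      ext m
      rw [pathAct_apply, Ideal.Quotient.eq_zero_iff_mem.2 hr, zero_smul]
      rfl
    rw [SetLike.mem_coe, TwoSidedIdeal.mem_ker, map_mul, map_mul, pairAct_extHom, h₁, mul_zero,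
      zero_mul]
  exact (TwoSidedIdeal.mem_ker _).1 (hle (TwoSidedIdeal.mem_asIdeal.1 hz))

/-- The ring map by which `KQᵉ/Iᵉ` acts. -/
noncomputable def quotAct : (PathAlgebra K (ExtVertex V) ⧸ extIdeal I) →+* Module.End K M :=
  Ideal.Quotient.lift (extIdeal I) (h.pairAct : PathAlgebra K (ExtVertex V) →+* Module.End K M)
    h.pairAct_eq_zero

end IsVertexwiseCompl

/-- The representation `M' = (N ⊆ M)` of `Qᵉ/Iᵉ` attached to a pair of representations `N ⊆ M` of
`Q/I` and a vertexwise complement of `N` in `M`. Its total space is `M = N ⊕ C`. -/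
def PairModule {N : Submodule (PathAlgebra K V ⧸ I) M} {C : Submodule K M}
    (_h : IsVertexwiseCompl N C) : Type t := M

namespace PairModule

variable {N : Submodule (PathAlgebra K V ⧸ I) M} {C : Submodule K M}
  (h : IsVertexwiseCompl N C)

instance : AddCommGroup (PairModule h) := inferInstanceAs (AddCommGroup M)

noncomputable instance : Module (PathAlgebra K (ExtVertex V) ⧸ extIdeal I) (PairModule h) :=
  letI : Module (Module.End K M) (PairModule h) := inferInstanceAs (Module (Module.End K M) M)
  Module.compHom (PairModule h) h.quotAct

end PairModule

end Pair

/-! ### Global dimension -/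

/-- The (left) global dimension of a ring: the supremum of the projective dimensions of its left
modules. -/
noncomputable def globalDimension (R : Type u) [Ring R] : WithBot ℕ∞ :=
  ⨆ X : ModuleCat.{u} R, projectiveDimension X

/-! Put `A = KQ/I`, `B = KQᵉ/Iᵉ`, `S = V → K`, and let `ε ∈ B` be the class of the sum of the
trivial paths at the vertices `(1, x)`. The only fact about quivers that matters is
`isLevelExtension_extIdeal`: `B` is `A` with an idempotent `ε` freely adjoined, subject to `ε a (1 -
ε) = 0` and to commuting with `S`. So a `B`-module `X` is an `A`-module with a submodule `bot = ker
ε` and an `S`-linear complement `εX`; for `X = (N ⊆ M)` these are `M`, `N` and `C`.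

The core is a criterion for projectivity when `S` is semisimple: `X` is projective over `B` exactly
when `X` and `X / bot` are projective over `A` and every `S`-linear map from `εX` to an `A`-module
extends to an `A`-linear map on `X` (in other words, `A ⊗_S εX → X` is a split injection). Necessity
is `projective_restrictScalars`, `projective_top` and `hasTopExtension_of_projective`; sufficiency
is `projective_of_hasTopExtension`. The functors `X ↦ X` and `X ↦ X / bot` to `A`-modules are exact
and preserve projectives, and the extension property passes to submodules. Hence second syzygies
over `B` are projective if `gldim A ≤ 2`.

For `Ext²`, let `L ⊆ P₁ → P₀ → X` be the start of a projective resolution; every `L → X` has to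
extend to `P₁`. Modulo `bot` it extends because `Ext²_A(X / bot, X / bot) = 0`. What remains is a
map `L → bot`, which extends `A`-linearly because `Ext²_A(X, bot) = 0`; the extension property of
`P₀` then allows a correction that makes it `B`-linear (`exists_extension_bot`). -/

/-! ### Second syzygies and `Ext²` -/

section Syzygies

variable {R : Type u} [Ring R] {L P₁ P₀ X Y : Type u}
  [AddCommGroup L] [AddCommGroup P₁] [AddCommGroup P₀] [AddCommGroup X] [AddCommGroup Y]
  [Module R L] [Module R P₁] [Module R P₀] [Module R X] [Module R Y]
  {i : L →ₗ[R] P₁} {d : P₁ →ₗ[R] P₀} {p : P₀ →ₗ[R] X}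

/-- The left half `0 → L → P₁ → ker p → 0` of the resolution, to be spliced with `0 → ker p → P₀ → X
→ 0` for dimension shifting. -/
lemma exists_shortExact_of_exact (hi : Function.Injective i) (hd : Function.Exact i d)
    (hp : Function.Exact d p) :
    ∃ S : ShortComplex (ModuleCat.{u} R), ∃ _ : S.ShortExact,
      S = ShortComplex.mk (ModuleCat.ofHom i)
        (ModuleCat.ofHom (d.codRestrict (LinearMap.ker p) fun x => hp.apply_apply_eq_zero x))
        (by
          ext x
          exact hd.apply_apply_eq_zero x) := by
  refine ⟨_, ModuleCat.shortComplex_shortExact _ ?_ ?_ ?_, rfl⟩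
  · intro x
    exact Subtype.ext_iff.trans (hd x)
  · exact hi
  · rintro ⟨x, hx⟩
    obtain ⟨y, rfl⟩ := (hp x).1 hx
    exact ⟨y, rfl⟩

/-- In a module of projective dimension at most two, second syzygies are projective. -/
lemma projective_syzygy [Module.Projective R P₁] [Module.Projective R P₀]
    (hi : Function.Injective i) (hd : Function.Exact i d) (hp : Function.Exact d p)
    (hs : Function.Surjective p) (hX : HasProjectiveDimensionLT (ModuleCat.of R X) 3) :
    Module.Projective R L := by
  obtain ⟨S, hS, rfl⟩ := exists_shortExact_of_exact hi hd hp
  have hT := LinearMap.shortExact_shortComplexKer hs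
  have h₁ : Projective (ModuleCat.of R P₁) := (IsProjective.iff_projective P₁).1 ‹_›
  have h₀ : Projective (ModuleCat.of R P₀) := (IsProjective.iff_projective P₀).1 ‹_›
  rw [IsProjective.iff_projective, projective_iff_hasProjectiveDimensionLT_one]
  exact (hS.hasProjectiveDimensionLT_X₃_iff 0 h₁).1
    ((hT.hasProjectiveDimensionLT_X₃_iff 1 h₀).1 hX)

lemma hasProjectiveDimensionLT_three [Module.Projective R P₁] [Module.Projective R P₀]
    [Module.Projective R L]
    (hi : Function.Injective i) (hd : Function.Exact i d) (hp : Function.Exact d p)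
    (hs : Function.Surjective p) : HasProjectiveDimensionLT (ModuleCat.of R X) 3 := by
  obtain ⟨S, hS, rfl⟩ := exists_shortExact_of_exact hi hd hp
  have hT := LinearMap.shortExact_shortComplexKer hs
  have h₁ : Projective (ModuleCat.of R P₁) := (IsProjective.iff_projective P₁).1 ‹_›
  have h₀ : Projective (ModuleCat.of R P₀) := (IsProjective.iff_projective P₀).1 ‹_›
  refine (hT.hasProjectiveDimensionLT_X₃_iff 1 h₀).2
    ((hS.hasProjectiveDimensionLT_X₃_iff 0 h₁).2 ?_)
  rw [zero_add, ← projective_iff_hasProjectiveDimensionLT_one]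
  exact (IsProjective.iff_projective L).1 ‹_›

open Abelian in
/-- `Ext²(X, Y)` vanishes if and only if all maps from the second syzygy of `X` to `Y` extend. -/
lemma subsingleton_ext_two_iff [Module.Projective R P₁] [Module.Projective R P₀]
    (hi : Function.Injective i) (hd : Function.Exact i d) (hp : Function.Exact d p)
    (hs : Function.Surjective p) :
    Subsingleton (Ext (ModuleCat.of R X) (ModuleCat.of R Y) 2) ↔
      ∀ f : L →ₗ[R] Y, ∃ g : P₁ →ₗ[R] Y, g ∘ₗ i = f := by
  obtain ⟨S, hS, hSe⟩ := exists_shortExact_of_exact hi hd hp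
  subst hSe
  have hT := LinearMap.shortExact_shortComplexKer hs
  have h₁ : Projective (ModuleCat.of R P₁) := (IsProjective.iff_projective P₁).1 ‹_›
  have h₀ : Projective (ModuleCat.of R P₀) := (IsProjective.iff_projective P₀).1 ‹_›
  constructor
  · intro h f
    -- The connecting map `Ext¹(ker p, Y) → Ext²(X, Y)` is injective because `Ext¹(P₀, Y) = 0`, and
    -- its target vanishes.
    have hf : hS.extClass.comp (Ext.mk₀ (ModuleCat.ofHom f)) (add_zero 1) = 0 := by
      obtain ⟨x, hx⟩ := Ext.contravariant_sequence_exact₁ hT _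
        (hS.extClass.comp (Ext.mk₀ (ModuleCat.ofHom f)) (add_zero 1)) (n₁ := 2) rfl
        (h.elim _ _)
      have hx₀ : x = 0 := Ext.eq_zero_of_projective (P := ModuleCat.of R P₀) x
      rw [← hx, hx₀, Ext.comp_zero]
    obtain ⟨x, hx⟩ := Ext.contravariant_sequence_exact₁ hS _ _ (add_zero 1) hf
    obtain ⟨g, rfl⟩ := Ext.addEquiv₀.symm.surjective x
    refine ⟨g.hom, ?_⟩
    have h₂ : Ext.mk₀ (ModuleCat.ofHom i ≫ g) = Ext.mk₀ (ModuleCat.ofHom f) := by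
      rw [← hx, ← Ext.mk₀_comp_mk₀]
      rfl
    have h₃ := (Ext.mk₀_bijective _ _).1 h₂
    exact congrArg ModuleCat.Hom.hom h₃
  · intro h
    refine subsingleton_of_forall_eq 0 fun e => ?_
    -- Every class in `Ext²(X, Y)` comes from `Hom(L, Y)` through two connecting maps; a map that
    -- extends to `P₁` is killed by the first one.
    obtain ⟨x, rfl⟩ := Ext.contravariant_sequence_exact₃ hT _ e
      (Ext.eq_zero_of_projective (P := ModuleCat.of R P₀) (n := 1) _) (n₀ := 1) rfl
    obtain ⟨y, rfl⟩ := Ext.contravariant_sequence_exact₃ hS _ x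
      (Ext.eq_zero_of_projective (P := ModuleCat.of R P₁) (n := 0) _) (n₀ := 0) rfl
    obtain ⟨f, rfl⟩ := Ext.addEquiv₀.symm.surjective y
    obtain ⟨g, hg⟩ := h f.hom
    have hf : f = ModuleCat.ofHom i ≫ ModuleCat.ofHom g := by
      ext x
      exact (LinearMap.congr_fun hg x).symm
    have h₂ : (Ext.addEquiv₀.symm f : Ext (ModuleCat.of R L) (ModuleCat.of R Y) 0) =
        (Ext.mk₀ (ModuleCat.ofHom i)).comp (Ext.mk₀ (ModuleCat.ofHom g)) (add_zero 0) := by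
      rw [Ext.mk₀_comp_mk₀, ← hf]
      rfl
    have h₃ : hS.extClass.comp (Ext.addEquiv₀.symm f) (add_zero 1) = 0 := by
      refine (congrArg (fun z => hS.extClass.comp z (add_zero 1)) h₂).trans ?_
      exact hS.extClass_comp_assoc _
    rw [h₃, Ext.comp_zero]

variable (R X) in
lemma exists_free_resolution : ∃ (P₀ P₁ L : Type u) (_ : AddCommGroup P₀) (_ : AddCommGroup P₁)
    (_ : AddCommGroup L) (_ : Module R P₀) (_ : Module R P₁) (_ : Module R L)
    (i : L →ₗ[R] P₁) (d : P₁ →ₗ[R] P₀) (p : P₀ →ₗ[R] X), Module.Projective R P₀ ∧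
      Module.Projective R P₁ ∧ Function.Injective i ∧ Function.Exact i d ∧ Function.Exact d p ∧
      Function.Surjective p := by
  have h (Z : Type u) [AddCommGroup Z] [Module R Z] :
      ∃ q : (Z →₀ R) →ₗ[R] Z, Function.Surjective q :=
    ⟨_, Finsupp.linearCombination_surjective R Function.surjective_id⟩
  obtain ⟨p, hp⟩ := h X
  obtain ⟨d, hd⟩ := h (LinearMap.ker p)
  refine ⟨X →₀ R, LinearMap.ker p →₀ R, LinearMap.ker d, inferInstance, inferInstance,
    inferInstance, inferInstance, inferInstance, inferInstance, (LinearMap.ker d).subtype,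
    (LinearMap.ker p).subtype ∘ₗ d, p, inferInstance, inferInstance,
    Submodule.injective_subtype _, ?_, ?_, hp⟩
  · rw [LinearMap.exact_iff, Submodule.range_subtype,
      LinearMap.ker_comp_of_ker_eq_bot _ (Submodule.ker_subtype _)]
  · rw [LinearMap.exact_iff, LinearMap.range_comp, LinearMap.range_eq_top.2 hd,
      Submodule.map_top, Submodule.range_subtype]

end Syzygies

lemma globalDimension_le_two_iff (R : Type u) [Ring R] :
    globalDimension R ≤ 2 ↔ ∀ X : ModuleCat.{u} R, HasProjectiveDimensionLT X 3 := by
  rw [globalDimension, iSup_le_iff]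
  exact forall_congr' fun X => projectiveDimension_le_iff X 2

/-! ### Rings with a freely adjoined level idempotent -/

/-- The ring `B` is obtained from the ring `A` by freely adjoining an idempotent `ε` which commutes
with the scalars from `S` and satisfies `ε a (1 - ε) = 0` for all `a` in `A`: a `B`-module is an
`A`-module with a submodule (the kernel of `ε`) and an `S`-linear complement (the image of `ε`). -/
structure IsLevelExtension (S : Type v) (A B : Type u) [Ring S] [Ring A] [Ring B] [Module S A]
    [Module A B] (ε : B) : Prop where
  idem : ε * ε = ε
  mul_smul_mul (a : A) : ε * (a • ε) = ε * (a • (1 : B))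
  comm (s : S) : ε * ((s • (1 : A)) • (1 : B)) = (s • (1 : A)) • ε
  generate : Subring.closure (insert ε (Set.range fun a : A => a • (1 : B))) = ⊤
  universal (M : Type u) [AddCommGroup M] [Module A M] (p : M →+ M) (hp : ∀ m, p (p m) = p m)
    (hl : ∀ (a : A) m, p (a • p m) = p (a • m))
    (hs : ∀ (s : S) m, p ((s • (1 : A)) • m) = (s • (1 : A)) • p m) :
    ∃ _ : Module B M, (∀ (a : A) (m : M), (a • (1 : B)) • m = a • m) ∧ ∀ m : M, ε • m = p m

/-! ### Coinduced modules -/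

/-- The additive group of `S`-linear maps from `A` to `N`, as a left `A`-module. -/
def CoindModule (S : Type v) (A N : Type u) [Ring S] [Ring A] [AddCommGroup N] [Module S A]
    [Module S N] : Type u := A →ₗ[S] N

namespace CoindModule

variable {S : Type v} {A N : Type u} [Ring S] [Ring A] [AddCommGroup N] [Module S A] [Module S N]

instance : AddCommGroup (CoindModule S A N) := inferInstanceAs (AddCommGroup (A →ₗ[S] N))

instance : FunLike (CoindModule S A N) A N := inferInstanceAs (FunLike (A →ₗ[S] N) A N)

@[ext] lemma ext {f g : CoindModule S A N} (h : ∀ a, f a = g a) : f = g := LinearMap.ext h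

@[simp] lemma add_apply (f g : CoindModule S A N) (a : A) : (f + g) a = f a + g a := rfl

@[simp] lemma zero_apply (a : A) : (0 : CoindModule S A N) a = 0 := rfl

lemma map_add (f : CoindModule S A N) (a b : A) : f (a + b) = f a + f b := LinearMap.map_add f a b

lemma map_zero (f : CoindModule S A N) : f 0 = 0 := LinearMap.map_zero f

lemma map_smul (f : CoindModule S A N) (s : S) (a : A) : f (s • a) = s • f a :=
  LinearMap.map_smul f s a

variable [IsScalarTower S A A]

/-- Right translation commutes with the `S`-action on `A` from the left, so it preserves
`S`-linearity. -/
instance : SMul A (CoindModule S A N) where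
  smul a f :=
    { toFun := fun b => f (b * a)
      map_add' := fun b c => by rw [add_mul, map_add]
      map_smul' := fun s b => by rw [smul_mul_assoc, map_smul]; rfl }

@[simp] lemma smul_apply (a : A) (f : CoindModule S A N) (b : A) : (a • f) b = f (b * a) := rfl

instance : Module A (CoindModule S A N) where
  one_smul f := by ext; simp
  mul_smul a b f := by ext; simp [mul_assoc]
  smul_zero a := by ext; simp
  smul_add a f g := by ext; simp
  add_smul a b f := by ext; simp [mul_add, map_add]
  zero_smul f := by ext; simp [map_zero]

end CoindModule

/-! ### Modules over a level extension -/

namespace IsLevelExtension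

variable {S : Type v} {A B : Type u} [Ring S] [Ring A] [Ring B] [Module S A] [Module A B] {ε : B}

lemma isScalarTower_of_smul_one [IsScalarTower A B B] {M : Type u} [AddCommGroup M] [Module A M]
    [Module B M] (h : ∀ (a : A) (m : M), (a • (1 : B)) • m = a • m) : IsScalarTower A B M :=
  ⟨fun a b m => by rw [← h a (b • m), ← mul_smul, smul_one_mul]⟩

variable (S) in
-- Scalars act through `s ↦ s • 1`. This serves for restriction along `S → A` and along `A → B`.
lemma exists_module_restrictScalars [IsScalarTower S A A] (M : Type u) [AddCommGroup M]
    [Module A M] : ∃ _ : Module S M, IsScalarTower S A M :=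
  letI := Module.compHom M (RingHom.smulOneHom : S →+* A)
  ⟨this, ⟨fun s a m => by
    change (s • a) • m = (s • (1 : A)) • a • m
    rw [← mul_smul, smul_one_mul]⟩⟩

variable (hε : IsLevelExtension S A B ε)
  {X Y Z : Type u} [AddCommGroup X] [AddCommGroup Y] [AddCommGroup Z]
  [Module B X] [Module B Y] [Module B Z] [Module A X] [Module A Y] [Module A Z]

include hε

omit [Module A X] in
lemma idem_smul (x : X) : ε • ε • x = ε • x := by rw [← mul_smul, hε.idem]

variable [IsScalarTower A B X]

lemma smul_smul_idem (a : A) (x : X) : ε • a • ε • x = ε • a • x := by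
  rw [← smul_assoc a ε x, ← mul_smul, hε.mul_smul_mul, mul_smul, smul_assoc, one_smul]

lemma smul_comm [Module S X] [IsScalarTower S A X] (s : S) (x : X) : ε • s • x = s • ε • x := by
  have h := congrArg (· • x) (hε.comm s)
  simpa only [mul_smul, smul_assoc, one_smul] using h

lemma smul_mem {W : AddSubgroup X} (hA : ∀ (a : A), ∀ x ∈ W, a • x ∈ W)
    (hW : ∀ x ∈ W, ε • x ∈ W) (b : B) : ∀ x ∈ W, b • x ∈ W := by
  have hb : b ∈ Subring.closure (insert ε (Set.range fun a : A => a • (1 : B))) := by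
    rw [hε.generate]
    trivial
  induction hb using Subring.closure_induction with
  | mem b hb =>
    rcases hb with rfl | ⟨a, rfl⟩
    · exact hW
    · intro x hx
      simpa only [smul_assoc, one_smul] using hA a x hx
  | zero =>
    intro x _
    rw [zero_smul]
    exact W.zero_mem
  | one =>
    intro x hx
    rwa [one_smul]
  | add b c _ _ hb hc =>
    intro x hx
    rw [add_smul]
    exact W.add_mem (hb x hx) (hc x hx)
  | neg b _ hb =>
    intro x hx
    rw [neg_smul]
    exact W.neg_mem (hb x hx)
  | mul b c _ _ hb hc =>
    intro x hx
    rw [mul_smul]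
    exact hb _ (hc x hx)

variable [IsScalarTower A B Y]

/-- `ε` and the image of `A` generate `B` as a ring, so compatibility need only be checked on them.
-/
lemma map_smul_of_map_idem (f : X →ₗ[A] Y) (hf : ∀ x, f (ε • x) = ε • f x) (b : B) (x : X) :
    f (b • x) = b • f x := by
  have hb : b ∈ Subring.closure (insert ε (Set.range fun a : A => a • (1 : B))) := by
    rw [hε.generate]
    trivial
  induction hb using Subring.closure_induction generalizing x with
  | mem b hb =>
    rcases hb with rfl | ⟨a, rfl⟩
    · exact hf x
    · simp only [smul_assoc, one_smul, map_smul]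
  | zero => simp only [zero_smul, map_zero]
  | one => simp only [one_smul]
  | add b c _ _ hb hc => simp only [add_smul, map_add, hb, hc]
  | neg b _ hb => simp only [neg_smul, map_neg, hb]
  | mul b c _ _ hb hc => simp only [mul_smul, hb, hc]

/-- An `A`-linear map which commutes with `ε` is `B`-linear. -/
def mkLinear (f : X →ₗ[A] Y) (hf : ∀ x, f (ε • x) = ε • f x) : X →ₗ[B] Y :=
  { toFun := f
    map_add' := f.map_add
    map_smul' := hε.map_smul_of_map_idem f hf }

variable (A X) in
/-- The submodule of a `B`-module on which `ε` vanishes. -/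
def bot : Submodule A X where
  carrier := {x | ε • x = 0}
  add_mem' {x y} hx hy := by
    rw [Set.mem_ofPred_eq] at *
    rw [smul_add, hx, hy, add_zero]
  zero_mem' := smul_zero ε
  smul_mem' a x hx := by
    rw [Set.mem_ofPred_eq] at *
    rw [← hε.smul_smul_idem, hx, smul_zero, smul_zero]

lemma mem_bot {x : X} : x ∈ hε.bot A X ↔ ε • x = 0 := Iff.rfl

lemma sub_mem_bot (x : X) : x - ε • x ∈ hε.bot A X := by
  rw [mem_bot, smul_sub, hε.idem_smul, sub_self]

lemma mkQ_idem_smul (x : X) : (hε.bot A X).mkQ (ε • x) = (hε.bot A X).mkQ x := by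
  refine ((Submodule.Quotient.eq _).2 ?_).symm
  exact hε.sub_mem_bot x

lemma map_mem_bot (f : X →ₗ[B] Y) {x : X} (hx : x ∈ hε.bot A X) : f x ∈ hε.bot A Y := by
  rw [mem_bot] at *
  rw [← map_smul, hx, map_zero]

/-- The map induced on the images of `ε`. -/
def topMap (f : X →ₗ[B] Y) : (X ⧸ hε.bot A X) →ₗ[A] (Y ⧸ hε.bot A Y) :=
  (hε.bot A X).mapQ (hε.bot A Y) (f.restrictScalars A) fun _ => hε.map_mem_bot f

@[simp] lemma topMap_mkQ (f : X →ₗ[B] Y) (x : X) :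
    hε.topMap f ((hε.bot A X).mkQ x) = (hε.bot A Y).mkQ (f x) := rfl

lemma mkQ_eq_zero {x : X} : (hε.bot A X).mkQ x = 0 ↔ ε • x = 0 := by
  rw [Submodule.mkQ_apply, Submodule.Quotient.mk_eq_zero, mem_bot]

lemma topMap_injective {f : X →ₗ[B] Y} (hf : Function.Injective f) :
    Function.Injective (hε.topMap f) := by
  rw [injective_iff_map_eq_zero]
  intro q hq
  obtain ⟨x, rfl⟩ := Submodule.mkQ_surjective _ q
  rw [topMap_mkQ, mkQ_eq_zero, ← map_smul] at hq
  rw [mkQ_eq_zero]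
  exact hf (hq.trans (map_zero f).symm)

lemma topMap_surjective {f : X →ₗ[B] Y} (hf : Function.Surjective f) :
    Function.Surjective (hε.topMap f) := by
  intro q
  obtain ⟨y, rfl⟩ := Submodule.mkQ_surjective _ q
  obtain ⟨x, rfl⟩ := hf y
  exact ⟨(hε.bot A X).mkQ x, rfl⟩

variable [IsScalarTower A B Z]

lemma topMap_exact {f : X →ₗ[B] Y} {g : Y →ₗ[B] Z}
    (h : Function.Exact f g) : Function.Exact (hε.topMap f) (hε.topMap g) := by
  intro q
  obtain ⟨y, rfl⟩ := Submodule.mkQ_surjective _ q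
  constructor
  · intro hy
    rw [topMap_mkQ, mkQ_eq_zero, ← map_smul] at hy
    obtain ⟨x, hx⟩ := (h _).1 hy
    exact ⟨(hε.bot A X).mkQ x, by rw [topMap_mkQ, hx, mkQ_idem_smul]⟩
  · rintro ⟨q, hq⟩
    obtain ⟨x, rfl⟩ := Submodule.mkQ_surjective _ q
    rw [← hq, topMap_mkQ, topMap_mkQ, h.apply_apply_eq_zero, map_zero]

/-! ### The extension property and projectivity over `B` -/

omit hε in
variable (S A X) in
/-- Every `S`-linear map on the image of `ε` extends to an `A`-linear map. -/
def HasTopExtension (ε : B) : Prop :=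
  ∀ (N : Type u) [AddCommGroup N] [Module A N] [Module S X] [IsScalarTower S A X] [Module S N]
    [IsScalarTower S A N] (k : X →ₗ[S] N), ∃ g : X →ₗ[A] N, ∀ x, g (ε • x) = k (ε • x)

variable [IsScalarTower S A A] [IsScalarTower A B B]

/-- An `S`-linear map into `N` is the same as an `A`-linear map into the coinduced module `H`. A
`B`-structure on `N × H` whose `ε` remembers evaluation at `1` turns lifting along `N × H → H` into
the required extension. -/
lemma hasTopExtension_of_projective [Module.Projective B X] : HasTopExtension S A X ε := by
  intro N _ _ _ _ _ _ k
  let H := CoindModule S A N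
  have hone (s : S) (f : H) : f (s • (1 : A)) = (s • (1 : A)) • f 1 := by
    rw [f.map_smul, smul_assoc, one_smul]
  -- `ε` projects onto the graph of evaluation at `1`, along `N × 0`. On the quotient `H` it becomes
  -- the identity.
  let p : N × H →+ N × H :=
    { toFun := fun t => (t.2 1, t.2)
      map_zero' := rfl
      map_add' := fun _ _ => rfl }
  obtain ⟨_, hT, hTε⟩ := hε.universal (N × H) p (fun _ => rfl)
    (fun _ _ => rfl)
    (fun s t => Prod.ext (by
      change t.2 (1 * (s • (1 : A))) = (s • (1 : A)) • t.2 1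
      rw [one_mul, hone]) rfl)
  obtain ⟨_, hH, hHε⟩ := hε.universal H (AddMonoidHom.id H) (fun _ => rfl)
    (fun _ _ => rfl) (fun _ _ => rfl)
  have := isScalarTower_of_smul_one hT
  have := isScalarTower_of_smul_one hH
  let q : N × H →ₗ[B] H := hε.mkLinear (LinearMap.snd A N H) fun t => by
    rw [hTε, hHε]
    rfl
  -- The adjoint of `x ↦ k (ε • x)`. It takes the same value at `x` and `ε • x` because `ε a ε = ε
  -- a`, hence is `B`-linear for `ε = 1` on `H`.
  let c (x : X) : H :=
    { toFun := fun a => k (ε • a • x)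
      map_add' := fun a b => by rw [add_smul, smul_add, map_add]
      map_smul' := fun s a => by
        rw [smul_assoc, hε.smul_comm, map_smul]
        rfl }
  have hc (x : X) (a : A) : c x a = k (ε • a • x) := rfl
  let r : X →ₗ[B] H := hε.mkLinear
    { toFun := c
      map_add' := fun x y => by
        ext a
        simp only [hc, smul_add, map_add]
        rfl
      map_smul' := fun b x => by
        ext a
        simp only [hc, RingHom.id_apply]
        rw [← mul_smul a b x]
        rfl }
    fun x => by
      rw [hHε]
      ext a
      change k (ε • a • ε • x) = k (ε • a • x)
      rw [hε.smul_smul_idem]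
  obtain ⟨t, ht⟩ := Module.projective_lifting_property q r fun f => ⟨(0, f), rfl⟩
  -- A lift sends `ε • x` into the graph, so its first component there is `c x 1 = k (ε • x)`.
  refine ⟨LinearMap.fst A N H ∘ₗ t.restrictScalars A, fun x => ?_⟩
  have h₁ : t (ε • x) = p (t x) := by rw [map_smul, hTε]
  have h₂ : (t x).2 = c x := LinearMap.congr_fun ht x
  change (t (ε • x)).1 = _
  rw [h₁]
  change (t x).2 1 = _
  rw [h₂, hc, one_smul]

-- Over a semisimple `S` the map `k` extends from `X` to `Y`; the extension property of `Y` then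
-- restricts to `X`.
omit hε [IsScalarTower A B B] in
lemma HasTopExtension.of_injective [IsSemisimpleRing S] (hY : HasTopExtension S A Y ε)
    {f : X →ₗ[B] Y} (hf : Function.Injective f) : HasTopExtension S A X ε := by
  intro N _ _ _ _ _ _ k
  obtain ⟨_, _⟩ := exists_module_restrictScalars S (A := A) Y
  obtain ⟨l, hl⟩ := IsSemisimpleModule.extension_property
    ((f.restrictScalars A).restrictScalars S) hf k
  obtain ⟨g, hg⟩ := hY N l
  refine ⟨g ∘ₗ f.restrictScalars A, fun x => ?_⟩
  have h₁ : g (f (ε • x)) = l (f (ε • x)) := by rw [map_smul, hg]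
  exact h₁.trans (LinearMap.congr_fun hl _)

/-- An `S`-linear lift of `g` agrees on `εX` with an `A`-linear map `l`. The error `g - f ∘ l` kills
`εX`, so it is `B`-linear into `N` with `ε = 0` and lifts by projectivity over `B`. -/
lemma projective_restrictScalars [IsSemisimpleRing S] [Module.Projective B X] :
    Module.Projective A X := by
  refine Module.Projective.of_lifting_property fun {M N} _ _ _ _ f g hf => ?_
  obtain ⟨_, _⟩ := exists_module_restrictScalars S (A := A) X
  obtain ⟨_, _⟩ := exists_module_restrictScalars S (A := A) M
  obtain ⟨_, _⟩ := exists_module_restrictScalars S (A := A) N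
  obtain ⟨k, hk⟩ := IsSemisimpleModule.lifting_property (f.restrictScalars S) hf
    (g.restrictScalars S)
  obtain ⟨l, hl⟩ := hε.hasTopExtension_of_projective M k
  obtain ⟨_, hM, hMε⟩ := hε.universal M 0 (fun _ => rfl) (fun _ _ => rfl)
    (fun _ _ => (smul_zero _).symm)
  obtain ⟨_, hN, hNε⟩ := hε.universal N 0 (fun _ => rfl) (fun _ _ => rfl)
    (fun _ _ => (smul_zero _).symm)
  have := isScalarTower_of_smul_one hM
  have := isScalarTower_of_smul_one hN
  have hr (x : X) : (g - f ∘ₗ l) (ε • x) = 0 := by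
    have h₁ : f (k (ε • x)) = g (ε • x) := LinearMap.congr_fun hk _
    rw [LinearMap.sub_apply, LinearMap.comp_apply, hl, h₁, sub_self]
  obtain ⟨t, ht⟩ := Module.projective_lifting_property
    (hε.mkLinear f fun m => by rw [hMε, hNε, AddMonoidHom.zero_apply, map_zero]; rfl)
    (hε.mkLinear (g - f ∘ₗ l) fun x => by rw [hr, hNε]; rfl) hf
  refine ⟨t.restrictScalars A + l, LinearMap.ext fun x => ?_⟩
  have h₁ : f (t x) = g x - f (l x) := LinearMap.congr_fun ht x
  change f (t x + l x) = g x
  rw [map_add, h₁, sub_add_cancel]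

-- `X ↦ X / bot` is left adjoint to the exact functor that lets `ε` act as the identity on an
-- `A`-module.
omit [IsScalarTower S A A] in
lemma projective_top [Module.Projective B X] : Module.Projective A (X ⧸ hε.bot A X) := by
  refine Module.Projective.of_lifting_property fun {M N} _ _ _ _ f g hf => ?_
  obtain ⟨_, hM, hMε⟩ := hε.universal M (AddMonoidHom.id M) (fun _ => rfl) (fun _ _ => rfl)
    (fun _ _ => rfl)
  obtain ⟨_, hN, hNε⟩ := hε.universal N (AddMonoidHom.id N) (fun _ => rfl) (fun _ _ => rfl)
    (fun _ _ => rfl)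
  have := isScalarTower_of_smul_one hM
  have := isScalarTower_of_smul_one hN
  obtain ⟨t, ht⟩ := Module.projective_lifting_property
    (hε.mkLinear f fun m => by rw [hMε, hNε]; rfl)
    (hε.mkLinear (g ∘ₗ (hε.bot A X).mkQ) fun x => by
      rw [hNε, LinearMap.comp_apply, mkQ_idem_smul]
      rfl) hf
  refine ⟨(hε.bot A X).liftQ (t.restrictScalars A) fun x hx => ?_, ?_⟩
  · have h₁ : ε • t x = t x := hMε _
    change t x = 0
    rw [← h₁, ← map_smul, hε.mem_bot.1 hx, map_zero]
  · refine Submodule.linearMap_qext _ (LinearMap.ext fun x => ?_)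
    exact LinearMap.congr_fun ht x

omit [IsScalarTower S A A] [IsScalarTower A B B] in
/-- Maps from `X` lift along surjections which are bijective on the kernels of `ε`. -/
lemma exists_lift_of_ker_top [Module.Projective A (X ⧸ hε.bot A X)] {q : Y →ₗ[B] Z}
    (hq : Function.Surjective q) (hk : ∀ y, q y = 0 → ε • y = y) (g : X →ₗ[B] Z) :
    ∃ f : X →ₗ[B] Y, q ∘ₗ f = g := by
  obtain ⟨u, hu⟩ := Module.projective_lifting_property (hε.topMap q) (hε.topMap g)
    (hε.topMap_surjective hq)
  -- Here `Y` is the pullback of `Z` and `Y / bot` over `Z / bot`: this gives existence and `huniq`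
  -- uniqueness, so the lift `u` on the tops determines the lift to `Y`.
  have hex (x : X) : ∃ y, q y = g x ∧ (hε.bot A Y).mkQ y = u ((hε.bot A X).mkQ x) := by
    obtain ⟨y₀, hy₀⟩ := hq (g x)
    obtain ⟨y₁, hy₁⟩ := Submodule.mkQ_surjective _ (u ((hε.bot A X).mkQ x))
    have h₁ : hε.topMap q (u ((hε.bot A X).mkQ x)) = (hε.bot A Z).mkQ (g x) :=
      LinearMap.congr_fun hu _
    rw [← hy₁, topMap_mkQ, ← sub_eq_zero, ← hy₀, ← map_sub, ← map_sub, mkQ_eq_zero,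
      ← map_smul] at h₁
    -- The correction lies in `ker q` and changes the class modulo `bot` to that of `y₁`.
    refine ⟨y₀ + ε • (y₁ - y₀), ?_, ?_⟩
    · rw [map_add, h₁, hy₀, add_zero]
    · rw [map_add, mkQ_idem_smul, ← map_add, add_sub_cancel, hy₁]
  have huniq (y y' : Y) (h₁ : q y = q y') (h₂ : (hε.bot A Y).mkQ y = (hε.bot A Y).mkQ y') :
      y = y' := by
    rw [← sub_eq_zero, ← map_sub] at h₁ h₂
    rw [mkQ_eq_zero, hk _ h₁, sub_eq_zero] at h₂
    exact h₂
  choose f hf₁ hf₂ using hex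
  refine ⟨hε.mkLinear
    { toFun := f
      map_add' := fun x x' => huniq _ _ (by simp only [hf₁, map_add])
        (by simp only [hf₂, map_add])
      map_smul' := fun a x => huniq _ _
        ((hf₁ (a • x)).trans (((g.restrictScalars A).map_smul a x).trans
          ((congrArg (a • ·) (hf₁ x).symm).trans ((q.restrictScalars A).map_smul a (f x)).symm)))
        (by simp only [hf₂, map_smul, RingHom.id_apply]) }
    fun x => huniq _ _
      (by
        change q (f (ε • x)) = q (ε • f x)
        rw [hf₁, map_smul, map_smul, hf₁])
      (by
        change (hε.bot A Y).mkQ (f (ε • x)) = (hε.bot A Y).mkQ (ε • f x)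
        rw [mkQ_idem_smul, hf₂, hf₂, mkQ_idem_smul]), LinearMap.ext hf₁⟩

omit [IsScalarTower A B B] in
/-- Maps from `X` lift along surjections which are bijective on the images of `ε`. -/
lemma exists_lift_of_ker_bot [Module.Projective A X] (hX : HasTopExtension S A X ε)
    {q : Y →ₗ[B] Z} (hq : Function.Surjective q) (hk : ∀ y, q y = 0 → ε • y = 0)
    (g : X →ₗ[B] Z) : ∃ f : X →ₗ[B] Y, q ∘ₗ f = g := by
  obtain ⟨_, _⟩ := exists_module_restrictScalars S (A := A) X
  obtain ⟨_, _⟩ := exists_module_restrictScalars S (A := A) Y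
  obtain ⟨v, hv⟩ := Module.projective_lifting_property (q.restrictScalars A)
    (g.restrictScalars A) hq
  have hqv (x : X) : q (v x) = g x := LinearMap.congr_fun hv x
  let K : Submodule A Y := LinearMap.ker (q.restrictScalars A)
  -- The failure of the `A`-linear lift `v` to commute with `ε`. It is only `S`-linear, but on `εX`
  -- it agrees with an `A`-linear map `w`, and `v + w` then sends `εX` into `εY`.
  let k : X →ₗ[S] K :=
    { toFun := fun x => ⟨ε • v x - v (ε • x), by
        refine LinearMap.mem_ker.2 ?_
        change q (ε • v x - v (ε • x)) = 0
        rw [map_sub, map_smul, hqv, hqv, map_smul, sub_self]⟩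
      map_add' := fun x y => Subtype.ext (by
        change ε • v (x + y) - v (ε • (x + y)) = (ε • v x - v (ε • x)) + (ε • v y - v (ε • y))
        rw [smul_add, map_add, map_add, smul_add]
        abel)
      map_smul' := fun s x => Subtype.ext (by
        change ε • v.restrictScalars S (s • x) - v.restrictScalars S (ε • (s • x)) =
          s • (ε • v x - v (ε • x))
        rw [map_smul, hε.smul_comm, hε.smul_comm, map_smul, smul_sub]
        rfl) }
  obtain ⟨w, hw⟩ := hX K k
  have hqw (x : X) : q (w x) = 0 := LinearMap.mem_ker.1 (w x).2
  let f : X →ₗ[A] Y := v + K.subtype ∘ₗ w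
  have hf (x : X) : f x = v x + w x := rfl
  have hqf (x : X) : q (f x) = g x := by rw [hf, map_add, hqv, hqw, add_zero]
  have h₁ (x : X) : f (ε • x) = ε • f x := by
    have hw' : (w (ε • x) : Y) = ε • v (ε • x) - v (ε • x) := by
      rw [hw]
      change ε • v (ε • x) - v (ε • ε • x) = _
      rw [hε.idem_smul]
    have h₂ : f (ε • x) = ε • v (ε • x) := by rw [hf, hw', add_sub_cancel]
    have h₃ : ε • f (ε • x) = f (ε • x) := by rw [h₂, hε.idem_smul]
    -- Commuting with `ε` on all of `X` follows since `ε` kills `ker q`.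
    have h₄ : q (ε • (f x - f (ε • x))) = 0 := by
      rw [map_smul, map_sub, hqf, hqf, map_smul, smul_sub, hε.idem_smul, sub_self]
    have h₅ := hk _ h₄
    rw [hε.idem_smul, smul_sub, h₃, sub_eq_zero] at h₅
    exact h₅.symm
  exact ⟨hε.mkLinear f h₁, LinearMap.ext hqf⟩

/-- A surjection `q` factors through `Y / W` with `W = ker q ∩ bot`. On the kernel of `Y / W → Z`
the idempotent acts as `1`, on `W` as `0`, so each factor falls under one of the two lifting lemmas.
-/
lemma projective_of_hasTopExtension [Module.Projective A X]
    [Module.Projective A (X ⧸ hε.bot A X)] (hX : HasTopExtension S A X ε) :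
    Module.Projective B X := by
  refine Module.Projective.of_lifting_property fun {Y Z} _ _ _ _ q g hq => ?_
  obtain ⟨_, _⟩ := exists_module_restrictScalars A (A := B) Y
  obtain ⟨_, _⟩ := exists_module_restrictScalars A (A := B) Z
  let W : Submodule B Y :=
    { carrier := {y | q y = 0 ∧ ε • y = 0}
      add_mem' := fun hx hy => ⟨by rw [map_add, hx.1, hy.1, add_zero],
        by rw [smul_add, hx.2, hy.2, add_zero]⟩
      zero_mem' := ⟨map_zero q, smul_zero ε⟩
      smul_mem' := fun b y hy => ⟨by rw [map_smul, hy.1, smul_zero],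
        hε.smul_mem (W := (hε.bot A Y).toAddSubgroup) (fun a _ => (hε.bot A Y).smul_mem a)
          (fun x hx => hε.mem_bot.2 ((hε.idem_smul x).trans hx)) b y hy.2⟩ }
  let r : (Y ⧸ W) →ₗ[B] Z := W.liftQ q fun _ hy => hy.1
  obtain ⟨f, hf⟩ := hε.exists_lift_of_ker_top (q := r)
    (fun z => (hq z).imp' W.mkQ fun _ hy => hy)
    (fun t ht => by
      obtain ⟨y, rfl⟩ := W.mkQ_surjective t
      have hy : q y = 0 := ht
      rw [← map_smul, ← sub_eq_zero, ← map_sub, Submodule.mkQ_apply, Submodule.Quotient.mk_eq_zero]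
      exact ⟨by rw [map_sub, map_smul, hy, smul_zero, sub_zero],
        by rw [smul_sub, hε.idem_smul, sub_self]⟩) g
  obtain ⟨t, ht⟩ := hε.exists_lift_of_ker_bot hX W.mkQ_surjective
    (fun y hy => ((Submodule.Quotient.mk_eq_zero W).1 hy).2) f
  refine ⟨t, LinearMap.ext fun x => ?_⟩
  have h₁ : r (W.mkQ (t x)) = g x := by
    rw [← hf, ← ht]
    rfl
  exact h₁

/-! ### Global dimension and `Ext²` over `B` -/

variable {L P₁ P₀ : Type u} [AddCommGroup L] [AddCommGroup P₁] [AddCommGroup P₀]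
  [Module B L] [Module B P₁] [Module B P₀] [Module A L] [Module A P₁] [Module A P₀]
  [IsScalarTower A B L] [IsScalarTower A B P₁] [IsScalarTower A B P₀]
  {i : L →ₗ[B] P₁} {d : P₁ →ₗ[B] P₀}

/-- The resolution stays a projective resolution over `A`, both after restriction and on the
quotients by `bot`, so `L` and `L / bot` are `A`-projective. The extension property is inherited
from `P₁`. -/
lemma projective_second_syzygy [IsSemisimpleRing S] [Module.Projective B P₁]
    [Module.Projective B P₀]
    (hA : ∀ X : ModuleCat.{u} A, HasProjectiveDimensionLT X 3)
    {p : P₀ →ₗ[B] X} (hi : Function.Injective i) (hd : Function.Exact i d)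
    (hp : Function.Exact d p) (hs : Function.Surjective p) : Module.Projective B L := by
  have h₁ : Module.Projective A P₁ := hε.projective_restrictScalars
  have h₀ : Module.Projective A P₀ := hε.projective_restrictScalars
  have h₁' : Module.Projective A (P₁ ⧸ hε.bot A P₁) := hε.projective_top
  have h₀' : Module.Projective A (P₀ ⧸ hε.bot A P₀) := hε.projective_top
  have hL : Module.Projective A L := projective_syzygy (i := i.restrictScalars A)
    (d := d.restrictScalars A) (p := p.restrictScalars A) hi hd hp hs (hA _)
  have hL' : Module.Projective A (L ⧸ hε.bot A L) :=
    projective_syzygy (hε.topMap_injective hi) (hε.topMap_exact hd)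
      (hε.topMap_exact hp) (hε.topMap_surjective hs) (hA _)
  exact hε.projective_of_hasTopExtension (hε.hasTopExtension_of_projective.of_injective hi)

/-- If the global dimension of `A` is at most two, then so is the global dimension of `B`. -/
theorem globalDimension_le_two [IsSemisimpleRing S] (hA : globalDimension A ≤ 2) :
    globalDimension B ≤ 2 := by
  rw [globalDimension_le_two_iff] at *
  intro X
  obtain ⟨P₀, P₁, L, _, _, _, _, _, _, i, d, p, _, _, hi, hd, hp, hs⟩ :=
    exists_free_resolution B X
  obtain ⟨_, _⟩ := exists_module_restrictScalars A (A := B) X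
  obtain ⟨_, _⟩ := exists_module_restrictScalars A (A := B) P₀
  obtain ⟨_, _⟩ := exists_module_restrictScalars A (A := B) P₁
  obtain ⟨_, _⟩ := exists_module_restrictScalars A (A := B) L
  have := hε.projective_second_syzygy hA hi hd hp hs
  exact hasProjectiveDimensionLT_three hi hd hp hs

omit [Module A L] [IsScalarTower A B L] in
/-- A map with values in the kernel of `ε` extends if it extends to an `A`-linear map. -/
lemma exists_extension_bot [IsSemisimpleRing S] [Module.Projective B P₀]
    (hd : Function.Exact i d) (f : L →ₗ[B] X) (hf : ∀ l, ε • f l = 0)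
    (g : P₁ →ₗ[A] hε.bot A X) (hg : ∀ l, (g (i l) : X) = f l) :
    ∃ t : P₁ →ₗ[B] X, t ∘ₗ i = f := by
  obtain ⟨_, _⟩ := exists_module_restrictScalars S (A := A) P₁
  obtain ⟨_, _⟩ := exists_module_restrictScalars S (A := A) P₀
  obtain ⟨_, _⟩ := exists_module_restrictScalars S (A := A) (hε.bot A X)
  let D : P₁ →ₗ[S] P₀ := (d.restrictScalars A).restrictScalars S
  -- A `B`-linear map into `bot` must vanish on `εP₁`, so `k` is the obstruction to `g` being
  -- `B`-linear. It vanishes on the image of `L` and hence factors `S`-linearly through `d`.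
  let k : P₁ →ₗ[S] hε.bot A X :=
    { toFun := fun x => g (ε • x)
      map_add' := fun x y => by rw [smul_add, map_add]
      map_smul' := fun s x => by
        rw [hε.smul_comm]
        exact (g.restrictScalars S).map_smul s _ }
  have hk : LinearMap.ker D ≤ LinearMap.ker k := by
    intro x hx
    obtain ⟨l, rfl⟩ := (hd x).1 hx
    refine Subtype.ext ?_
    change (g (ε • i l) : X) = 0
    rw [← map_smul, hg, map_smul, hf]
  obtain ⟨m, hm⟩ := IsSemisimpleModule.extension_property ((LinearMap.ker D).liftQ D le_rfl)
    (LinearMap.ker_eq_bot.1 (Submodule.ker_liftQ_eq_bot _ _ _ le_rfl))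
    ((LinearMap.ker D).liftQ k hk)
  have hm' (x : P₁) : m (d x) = g (ε • x) := LinearMap.congr_fun hm ((LinearMap.ker D).mkQ x)
  obtain ⟨w, hw⟩ := hε.hasTopExtension_of_projective (X := P₀) _ m
  have hwd (x : P₁) : w (d (ε • x)) = g (ε • x) := by
    rw [map_smul, hw, ← map_smul, hm', hε.idem_smul]
  -- The correction `w ∘ d` does not affect the restriction to `L`, and equals `g` on `εP₁`.
  let t : P₁ →ₗ[A] X := (hε.bot A X).subtype ∘ₗ (g - w ∘ₗ d.restrictScalars A)
  have ht (x : P₁) : t x = g x - w (d x) := rfl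
  refine ⟨hε.mkLinear t fun x => ?_, LinearMap.ext fun l => ?_⟩
  · rw [ht, hwd, sub_self]
    exact (g x - w (d x)).2.symm
  · change t (i l) = f l
    rw [ht, hd.apply_apply_eq_zero, map_zero, hg]
    exact sub_zero _

/-- The extension `u` on the tops lifts to a `B`-linear `g : P₁ → X`, since `P₁` is projective and
`X → X / bot` is `B`-linear when `ε` acts as `1` on the target. The difference `f - g ∘ i` takes
values in `bot`. -/
lemma exists_extension [IsSemisimpleRing S] [Module.Projective B P₁] [Module.Projective B P₀]
    (hd : Function.Exact i d)
    (htop : ∀ f : (L ⧸ hε.bot A L) →ₗ[A] (X ⧸ hε.bot A X),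
      ∃ g : (P₁ ⧸ hε.bot A P₁) →ₗ[A] (X ⧸ hε.bot A X), g ∘ₗ hε.topMap i = f)
    (hbot : ∀ f : L →ₗ[A] hε.bot A X,
      ∃ g : P₁ →ₗ[A] hε.bot A X, g ∘ₗ i.restrictScalars A = f)
    (f : L →ₗ[B] X) : ∃ g : P₁ →ₗ[B] X, g ∘ₗ i = f := by
  obtain ⟨u, hu⟩ := htop (hε.topMap f)
  obtain ⟨_, hM, hMε⟩ := hε.universal (X ⧸ hε.bot A X) (AddMonoidHom.id _) (fun _ => rfl)
    (fun _ _ => rfl) (fun _ _ => rfl)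
  have := isScalarTower_of_smul_one hM
  obtain ⟨g, hg⟩ := Module.projective_lifting_property
    (hε.mkLinear (hε.bot A X).mkQ fun x => by
      rw [hMε, mkQ_idem_smul]
      rfl)
    (hε.mkLinear (u ∘ₗ (hε.bot A P₁).mkQ) fun x => by
      rw [hMε, LinearMap.comp_apply, mkQ_idem_smul]
      rfl) (hε.bot A X).mkQ_surjective
  have hgu (x : P₁) : (hε.bot A X).mkQ (g x) = u ((hε.bot A P₁).mkQ x) := LinearMap.congr_fun hg x
  have hr (l : L) : ε • (f - g ∘ₗ i) l = 0 := by
    have h₁ : u ((hε.bot A P₁).mkQ (i l)) = (hε.bot A X).mkQ (f l) :=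
      LinearMap.congr_fun hu ((hε.bot A L).mkQ l)
    rw [← hε.mkQ_eq_zero (A := A), LinearMap.sub_apply, map_sub, LinearMap.comp_apply, hgu, h₁,
      sub_self]
  obtain ⟨h, hh⟩ := hbot (((f - g ∘ₗ i).restrictScalars A).codRestrict (hε.bot A X) hr)
  obtain ⟨t, ht⟩ := hε.exists_extension_bot hd (f - g ∘ₗ i) hr h fun l =>
    congrArg Subtype.val (LinearMap.congr_fun hh l)
  exact ⟨g + t, by rw [LinearMap.add_comp, ht, add_sub_cancel]⟩

open Abelian in
theorem subsingleton_ext_two [IsSemisimpleRing S]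
    (htop : Subsingleton (Ext (ModuleCat.of A (X ⧸ hε.bot A X))
      (ModuleCat.of A (X ⧸ hε.bot A X)) 2))
    (hbot : Subsingleton (Ext (ModuleCat.of A X) (ModuleCat.of A (hε.bot A X)) 2)) :
    Subsingleton (Ext (ModuleCat.of B X) (ModuleCat.of B X) 2) := by
  obtain ⟨P₀, P₁, L, _, _, _, _, _, _, i, d, p, _, _, hi, hd, hp, hs⟩ :=
    exists_free_resolution B X
  obtain ⟨_, _⟩ := exists_module_restrictScalars A (A := B) P₀
  obtain ⟨_, _⟩ := exists_module_restrictScalars A (A := B) P₁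
  obtain ⟨_, _⟩ := exists_module_restrictScalars A (A := B) L
  have h₁ : Module.Projective A P₁ := hε.projective_restrictScalars
  have h₀ : Module.Projective A P₀ := hε.projective_restrictScalars
  have h₁' : Module.Projective A (P₁ ⧸ hε.bot A P₁) := hε.projective_top
  have h₀' : Module.Projective A (P₀ ⧸ hε.bot A P₀) := hε.projective_top
  rw [subsingleton_ext_two_iff hi hd hp hs]
  exact hε.exists_extension hd
    ((subsingleton_ext_two_iff (hε.topMap_injective hi) (hε.topMap_exact hd)
      (hε.topMap_exact hp) (hε.topMap_surjective hs)).1 htop)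
    ((subsingleton_ext_two_iff (i := i.restrictScalars A) (d := d.restrictScalars A)
      (p := p.restrictScalars A) hi hd hp hs).1 hbot)

end IsLevelExtension

/-! ### Levels in the path algebra of the extension quiver -/

namespace PathAlgebra

section Level

variable (K : Type u) [Field K] (V : Type v) [Fintype V] [Quiver.{w} V]

/-- The sum of the trivial paths at the vertices `(i, x)` of the extension quiver. -/
noncomputable def levelIdem (i : Fin 2) : PathAlgebra K (ExtVertex V) :=
  ∑ x : V, idem K (ExtVertex.mk i x)

lemma levelIdem_add : levelIdem K V 0 + levelIdem K V 1 = 1 := by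
  rw [← sum_idem, ExtVertex.sum_eq]
  rfl

variable {V}

lemma levelIdem_mul_idem (s : ExtVertex V) : levelIdem K V s.level * idem K s = idem K s := by
  rw [levelIdem, Finset.sum_mul, Finset.sum_eq_single s.vertex]
  · exact idem_mul_idem K s
  · intro x _ hx
    exact idem_mul_idem_of_ne K fun h => hx (congrArg ExtVertex.vertex h)
  · simp

lemma levelIdem_mul_idem_of_ne {i : Fin 2} {s : ExtVertex V} (h : i ≠ s.level) :
    levelIdem K V i * idem K s = 0 := by
  rw [levelIdem, Finset.sum_mul]
  exact Finset.sum_eq_zero fun x _ =>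
    idem_mul_idem_of_ne K fun hx => h (congrArg ExtVertex.level hx)

lemma idem_mul_levelIdem (s : ExtVertex V) : idem K s * levelIdem K V s.level = idem K s := by
  rw [levelIdem, Finset.mul_sum, Finset.sum_eq_single s.vertex]
  · exact idem_mul_idem K s
  · intro x _ hx
    exact idem_mul_idem_of_ne K fun h => hx (congrArg ExtVertex.vertex h).symm
  · simp

lemma idem_mul_levelIdem_of_ne {i : Fin 2} {s : ExtVertex V} (h : i ≠ s.level) :
    idem K s * levelIdem K V i = 0 := by
  rw [levelIdem, Finset.mul_sum]
  exact Finset.sum_eq_zero fun x _ =>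
    idem_mul_idem_of_ne K fun hx => h (congrArg ExtVertex.level hx).symm

lemma idem_mul_ofPath {W : Type v} [Fintype W] [Quiver.{w} W] {s t : W} (p : Quiver.Path s t) :
    idem K t * ofPath K p = ofPath K p := ofPath_mul_ofPath K _ _

lemma ofPath_mul_idem {W : Type v} [Fintype W] [Quiver.{w} W] {s t : W} (p : Quiver.Path s t) :
    ofPath K p * idem K s = ofPath K p :=
  (ofPath_mul_ofPath K _ _).trans (by rw [Quiver.Path.nil_comp])

lemma levelIdem_mul_self (i : Fin 2) : levelIdem K V i * levelIdem K V i = levelIdem K V i := by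
  conv_lhs => rw [levelIdem, Finset.sum_mul]
  exact Finset.sum_congr rfl fun x _ => idem_mul_levelIdem K (ExtVertex.mk i x)

lemma levelIdem_mul_extIdem (i : Fin 2) (x : V) :
    levelIdem K V i * extIdem K x = idem K (ExtVertex.mk i x) := by
  rw [extIdem, mul_add]
  fin_cases i
  · exact (congrArg₂ _ (levelIdem_mul_idem K (ExtVertex.mk 0 x))
      (levelIdem_mul_idem_of_ne K zero_ne_one)).trans (add_zero _)
  · exact (congrArg₂ _ (levelIdem_mul_idem_of_ne K one_ne_zero)
      (levelIdem_mul_idem K (ExtVertex.mk 1 x))).trans (zero_add _)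

lemma extIdem_mul_levelIdem (i : Fin 2) (x : V) :
    extIdem K x * levelIdem K V i = idem K (ExtVertex.mk i x) := by
  rw [extIdem, add_mul]
  fin_cases i
  · exact (congrArg₂ _ (idem_mul_levelIdem K (ExtVertex.mk 0 x))
      (idem_mul_levelIdem_of_ne K zero_ne_one)).trans (add_zero _)
  · exact (congrArg₂ _ (idem_mul_levelIdem_of_ne K one_ne_zero)
      (idem_mul_levelIdem K (ExtVertex.mk 1 x))).trans (zero_add _)

lemma levelIdem_mul_ofPath {s t : ExtVertex V} (p : Quiver.Path s t) :
    levelIdem K V t.level * ofPath K p = ofPath K p := by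
  rw [← idem_mul_ofPath K p, ← mul_assoc, levelIdem_mul_idem]

lemma levelIdem_mul_ofPath_of_ne {s t : ExtVertex V} (p : Quiver.Path s t) {i : Fin 2}
    (h : i ≠ t.level) : levelIdem K V i * ofPath K p = 0 := by
  rw [← idem_mul_ofPath K p, ← mul_assoc, levelIdem_mul_idem_of_ne K h, zero_mul]

lemma ofPath_mul_levelIdem {s t : ExtVertex V} (p : Quiver.Path s t) :
    ofPath K p * levelIdem K V s.level = ofPath K p := by
  rw [← ofPath_mul_idem K p, mul_assoc, idem_mul_levelIdem]

lemma ofPath_mul_levelIdem_of_ne {s t : ExtVertex V} (p : Quiver.Path s t) {i : Fin 2}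
    (h : i ≠ s.level) : ofPath K p * levelIdem K V i = 0 := by
  rw [← ofPath_mul_idem K p, mul_assoc, idem_mul_levelIdem_of_ne K h, mul_zero]

omit [Fintype V] in
lemma level_le_of_path {s t : ExtVertex V} (p : Quiver.Path s t) : t.level ≤ s.level := by
  induction p with
  | nil => exact le_rfl
  | cons p a ih => exact a.2.trans ih

/-- Arrows never raise the level, so no path leads from level `0` to level `1`. -/
lemma levelIdem_one_mul_mul_levelIdem_zero (z : PathAlgebra K (ExtVertex V)) :
    levelIdem K V 1 * z * levelIdem K V 0 = 0 := by
  have h : (LinearMap.mulRight K (levelIdem K V 0)) ∘ₗ (LinearMap.mulLeft K (levelIdem K V 1)) =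
      0 := by
    refine lin_ext K fun s t p => ?_
    change levelIdem K V 1 * ofPath K p * levelIdem K V 0 = 0
    by_cases ht : 1 = t.level
    · have hs : (0 : Fin 2) ≠ s.level := by
        have := level_le_of_path p
        intro hs
        rw [← ht, ← hs] at this
        exact absurd this (by decide)
      rw [mul_assoc, ofPath_mul_levelIdem_of_ne K p hs, mul_zero]
    · rw [levelIdem_mul_ofPath_of_ne K p ht, zero_mul]
  exact LinearMap.congr_fun h z

/-- The level idempotents single out one of the three summands of `a'`, which shows that `a'` and
the levels generate all arrows. -/
lemma levelIdem_mul_extArrow_mul {s t : ExtVertex V} (a : s ⟶ t) :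
    levelIdem K V t.level * extArrow K a.1 * levelIdem K V s.level = ofArrow K a := by
  obtain ⟨i, x⟩ := s
  obtain ⟨j, y⟩ := t
  obtain ⟨a, h⟩ := a
  change x ⟶ y at a
  have hl {i j l : Fin 2} (h : j ≤ i) : levelIdem K V l * ofArrow K (ExtVertex.arrow h a) =
      if l = j then ofArrow K (ExtVertex.arrow h a) else 0 := by
    split_ifs with hlj
    · subst hlj
      exact levelIdem_mul_ofPath K (ExtVertex.arrow h a).toPath
    · exact levelIdem_mul_ofPath_of_ne K (ExtVertex.arrow h a).toPath hlj
  have hr {i j l : Fin 2} (h : j ≤ i) : ofArrow K (ExtVertex.arrow h a) * levelIdem K V l =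
      if l = i then ofArrow K (ExtVertex.arrow h a) else 0 := by
    split_ifs with hlj
    · subst hlj
      exact ofPath_mul_levelIdem K (ExtVertex.arrow h a).toPath
    · exact ofPath_mul_levelIdem_of_ne K (ExtVertex.arrow h a).toPath hlj
  change levelIdem K V j * extArrow K a * levelIdem K V i = ofArrow K (ExtVertex.arrow h a)
  simp only [extArrow, mul_add, add_mul, hl, ite_mul, zero_mul, hr]
  have h' : j ≤ i := h
  fin_cases i <;> fin_cases j
  · simp
  · exact absurd h' (by decide)
  · simp
  · simp

variable {K} in
-- The generators of `Iᵉ` are the homogeneous components of `r'`, and `r'` is their sum because the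
-- trivial paths add up to `1`.
lemma extHom_mem_extIdeal {I : Ideal (PathAlgebra K V)} {r : PathAlgebra K V} (hr : r ∈ I) :
    extHom K r ∈ extIdeal I := by
  have h : extHom K r = ∑ t : ExtVertex V, ∑ s : ExtVertex V,
      idem K t * extHom K r * idem K s := by
    simp only [← Finset.mul_sum]
    rw [← Finset.sum_mul, ← Finset.sum_mul, sum_idem, one_mul, mul_one]
  rw [h]
  refine Ideal.sum_mem _ fun t _ => Ideal.sum_mem _ fun s _ => ?_
  exact TwoSidedIdeal.mem_asIdeal.2 (TwoSidedIdeal.subset_span ⟨r, hr, s, t, rfl⟩)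

end Level

/-! ### The quotient `KQᵉ/Iᵉ` as a ring over `KQ/I` -/

section Quotient

variable {K : Type u} [Field K] {V : Type v} [Fintype V] [Quiver.{w} V]
  (I : Ideal (PathAlgebra K V)) [I.IsTwoSided]

/-- The ring map `KQ/I → KQᵉ/Iᵉ` induced by `a ↦ a'`. -/
noncomputable def extQuotHom :
    PathAlgebra K V ⧸ I →+* PathAlgebra K (ExtVertex V) ⧸ extIdeal I :=
  Ideal.Quotient.lift I ((Ideal.Quotient.mk (extIdeal I)).comp (extHom K).toRingHom) fun _ hr =>
    Ideal.Quotient.eq_zero_iff_mem.2 (extHom_mem_extIdeal hr)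

lemma extQuotHom_mk (z : PathAlgebra K V) : extQuotHom I (Ideal.Quotient.mk I z) =
    Ideal.Quotient.mk (extIdeal I) (extHom K z) := rfl

variable (K V) in
/-- The ring map from the span of the vertices to the path algebra. -/
noncomputable def vertexHom : (V → K) →+* PathAlgebra K V where
  toFun c := ∑ x, c x • idem K x
  map_one' := by simp [sum_idem]
  map_zero' := by simp
  map_add' c d := by simp [add_smul, Finset.sum_add_distrib]
  map_mul' c d := by
    rw [Finset.sum_mul]
    refine Finset.sum_congr rfl fun x _ => ?_
    rw [Finset.mul_sum, Finset.sum_eq_single x]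
    · rw [smul_mul_smul_comm, idem_mul_idem]
      rfl
    · intro y _ hy
      rw [smul_mul_smul_comm, idem_mul_idem_of_ne K hy.symm, smul_zero]
    · simp

lemma vertexHom_apply (c : V → K) : vertexHom K V c = ∑ x, c x • idem K x := rfl

/-- This is the base ring `S`: a finite product of fields, hence semisimple. Linearity over it means
`K`-linearity together with compatibility with the decomposition over the vertices. -/
noncomputable instance : Module (V → K) (PathAlgebra K V ⧸ I) :=
  Module.compHom _ ((Ideal.Quotient.mk I).comp (vertexHom K V))

noncomputable instance :
    Module (PathAlgebra K V ⧸ I) (PathAlgebra K (ExtVertex V) ⧸ extIdeal I) :=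
  Module.compHom _ (extQuotHom I)

lemma vertex_smul_def (c : V → K) (a : PathAlgebra K V ⧸ I) :
    c • a = Ideal.Quotient.mk I (vertexHom K V c) * a := rfl

lemma ext_smul_def (a : PathAlgebra K V ⧸ I) (b : PathAlgebra K (ExtVertex V) ⧸ extIdeal I) :
    a • b = extQuotHom I a * b := rfl

instance : IsScalarTower (V → K) (PathAlgebra K V ⧸ I) (PathAlgebra K V ⧸ I) :=
  ⟨fun _ _ _ => mul_assoc _ _ _⟩

instance : IsScalarTower (PathAlgebra K V ⧸ I) (PathAlgebra K (ExtVertex V) ⧸ extIdeal I)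
    (PathAlgebra K (ExtVertex V) ⧸ extIdeal I) :=
  ⟨fun _ _ _ => mul_assoc _ _ _⟩

lemma extHom_vertexHom (c : V → K) : extHom K (vertexHom K V c) = ∑ x, c x • extIdem K x := by
  rw [vertexHom_apply, map_sum]
  exact Finset.sum_congr rfl fun x _ => by rw [map_smul, extHom_idem]

lemma levelIdem_mul_extHom_vertexHom (i : Fin 2) (c : V → K) :
    levelIdem K V i * extHom K (vertexHom K V c) =
      extHom K (vertexHom K V c) * levelIdem K V i := by
  rw [extHom_vertexHom, Finset.mul_sum, Finset.sum_mul]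
  exact Finset.sum_congr rfl fun x _ => by
    rw [mul_smul_comm, smul_mul_assoc, levelIdem_mul_extIdem, extIdem_mul_levelIdem]

lemma closure_extQuot_eq_top : Subring.closure
    (insert (Ideal.Quotient.mk (extIdeal I) (levelIdem K V 1)) (Set.range fun a : PathAlgebra K V ⧸ I =>
      a • (1 : PathAlgebra K (ExtVertex V) ⧸ extIdeal I))) = ⊤ := by
  set R := Subring.closure
    (insert (Ideal.Quotient.mk (extIdeal I) (levelIdem K V 1)) (Set.range fun a : PathAlgebra K V ⧸ I =>
      a • (1 : PathAlgebra K (ExtVertex V) ⧸ extIdeal I))) with hR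
  have hext (z : PathAlgebra K V) : Ideal.Quotient.mk (extIdeal I) (extHom K z) ∈ R := by
    refine Subring.subset_closure (Set.mem_insert_of_mem _ ⟨Ideal.Quotient.mk I z, ?_⟩)
    change _ • _ = _
    rw [ext_smul_def, mul_one, extQuotHom_mk]
  have hone : Ideal.Quotient.mk (extIdeal I) (levelIdem K V 1) ∈ R :=
    Subring.subset_closure (Set.mem_insert _ _)
  have hlev (i : Fin 2) : Ideal.Quotient.mk (extIdeal I) (levelIdem K V i) ∈ R := by
    fin_cases i
    · have h₀ : levelIdem K V 0 = 1 - levelIdem K V 1 := eq_sub_of_add_eq (levelIdem_add K V)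
      change Ideal.Quotient.mk (extIdeal I) (levelIdem K V 0) ∈ R
      rw [h₀, map_sub, map_one]
      exact R.sub_mem R.one_mem hone
    · exact hone
  have hpath {s t : ExtVertex V} (p : Quiver.Path s t) :
      Ideal.Quotient.mk (extIdeal I) (ofPath K p) ∈ R := by
    induction p with
    | nil =>
      have h := levelIdem_mul_extIdem K s.level s.vertex
      rw [← extHom_idem] at h
      change Ideal.Quotient.mk (extIdeal I) (idem K (ExtVertex.mk s.level s.vertex)) ∈ R
      rw [← h, map_mul]
      exact R.mul_mem (hlev _) (hext _)
    | cons p a ih =>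
      rw [ofPath_cons, map_mul, ← levelIdem_mul_extArrow_mul, ← extHom_ofArrow, map_mul, map_mul]
      exact R.mul_mem (R.mul_mem (R.mul_mem (hlev _) (hext _)) (hlev _)) ih
  -- `Subring.closure` knows nothing of `K`; scalars are recovered as images of the scalars of `KQ`.
  have hsmul (c : K) (z : PathAlgebra K (ExtVertex V))
      (hz : Ideal.Quotient.mk (extIdeal I) z ∈ R) :
      Ideal.Quotient.mk (extIdeal I) (c • z) ∈ R := by
    rw [Algebra.smul_def, ← (extHom K).commutes c, map_mul]
    exact R.mul_mem (hext _) hz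
  rw [eq_top_iff]
  intro b _
  obtain ⟨z, rfl⟩ := Ideal.Quotient.mk_surjective b
  let W : Submodule K (PathAlgebra K (ExtVertex V)) :=
    { carrier := {z | Ideal.Quotient.mk (extIdeal I) z ∈ R}
      add_mem' := fun {y z} hy hz => by
        change Ideal.Quotient.mk (extIdeal I) (y + z) ∈ R
        rw [map_add]
        exact R.add_mem hy hz
      zero_mem' := by
        change Ideal.Quotient.mk (extIdeal I) 0 ∈ R
        rw [map_zero]
        exact R.zero_mem
      smul_mem' := fun c z hz => hsmul c z hz }
  have hW : W.mkQ = 0 := lin_ext K fun s t p =>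
    (Submodule.Quotient.mk_eq_zero W).2 (hpath p)
  exact (Submodule.Quotient.mk_eq_zero W).1 (LinearMap.congr_fun hW z)

end Quotient

end PathAlgebra

open PathAlgebra

/-! ### Pairs `N ⊆ M` seen through the level idempotent -/

section Pair

variable {K : Type u} [Field K] {V : Type v} [Fintype V] [Quiver.{w} V]
  {I : Ideal (PathAlgebra K V)} [I.IsTwoSided]
  {M : Type t} [AddCommGroup M] [Module K M] [Module (PathAlgebra K V ⧸ I) M]
  [IsScalarTower K (PathAlgebra K V ⧸ I) M]
  {N : Submodule (PathAlgebra K V ⧸ I) M} {C : Submodule K M} (h : IsVertexwiseCompl N C)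

lemma IsVertexwiseCompl.pairAct_levelIdem (i : Fin 2) :
    h.pairAct (levelIdem K V i) = h.proj i := by
  rw [levelIdem, map_sum]
  simp only [h.pairAct_idem]
  rw [← Finset.mul_sum, ← map_sum, sum_idem, map_one, mul_one]

lemma IsVertexwiseCompl.proj_one_eq_zero_iff (m : M) : h.proj 1 m = 0 ↔ m ∈ N := by
  have hm : h.proj 0 m + h.proj 1 m = m := LinearMap.congr_fun h.proj_add m
  constructor
  · intro h₁
    rw [h₁, add_zero] at hm
    rw [← hm]
    exact h.proj_zero_mem m
  · intro h₁
    rwa [h.proj_zero_of_mem h₁, add_eq_left] at hm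

namespace PairModule

instance : Module (PathAlgebra K V ⧸ I) (PairModule h) :=
  inferInstanceAs (Module (PathAlgebra K V ⧸ I) M)

lemma ext_smul_one_smul (a : PathAlgebra K V ⧸ I) (m : PairModule h) :
    (a • (1 : PathAlgebra K (ExtVertex V) ⧸ extIdeal I)) • m = a • m := by
  obtain ⟨z, rfl⟩ := Ideal.Quotient.mk_surjective a
  rw [ext_smul_def, mul_one, extQuotHom_mk]
  exact LinearMap.congr_fun (h.pairAct_extHom z) m

lemma levelIdem_smul (i : Fin 2) (m : PairModule h) :
    Ideal.Quotient.mk (extIdeal I) (levelIdem K V i) • m = h.proj i m :=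
  LinearMap.congr_fun (h.pairAct_levelIdem i) m

end PairModule

end Pair

/-- The path algebra of the extension quiver with its relations is obtained from `KQ/I` by
adjoining an idempotent. -/
theorem isLevelExtension_extIdeal {K : Type u} [Field K] {V : Type v} [Fintype V] [Quiver.{w} V]
    (I : Ideal (PathAlgebra K V)) [I.IsTwoSided] :
    IsLevelExtension (V → K) (PathAlgebra K V ⧸ I) (PathAlgebra K (ExtVertex V) ⧸ extIdeal I)
      (Ideal.Quotient.mk (extIdeal I) (levelIdem K V 1)) where
  idem := by rw [← map_mul, levelIdem_mul_self]
  mul_smul_mul a := by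
    obtain ⟨z, rfl⟩ := Ideal.Quotient.mk_surjective a
    rw [ext_smul_def, ext_smul_def, extQuotHom_mk, mul_one, ← map_mul, ← map_mul, ← map_mul]
    have h := levelIdem_one_mul_mul_levelIdem_zero K (extHom K z)
    rw [eq_sub_of_add_eq (levelIdem_add K V), mul_sub, mul_one, sub_eq_zero] at h
    rw [← mul_assoc, ← h]
  comm c := by
    rw [ext_smul_def, ext_smul_def, vertex_smul_def, mul_one, mul_one, extQuotHom_mk, ← map_mul,
      ← map_mul, levelIdem_mul_extHom_vertexHom]
  generate := closure_extQuot_eq_top I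
  universal M _ _ p hp hl hs := by
    let _ : Module K M := Module.compHom M (algebraMap K (PathAlgebra K V ⧸ I))
    have : IsScalarTower K (PathAlgebra K V ⧸ I) M := ⟨fun c a m => by
      rw [Algebra.smul_def, mul_smul]
      rfl⟩
    have hc (c : V → K) (m : M) : p (Ideal.Quotient.mk I (vertexHom K V c) • m) =
        Ideal.Quotient.mk I (vertexHom K V c) • p m := by
      have := hs c m
      rwa [vertex_smul_def, mul_one] at this
    -- `K` embeds in `V → K` as the constant functions, so compatibility of `p` with `S` includes
    -- `K`-linearity.
    have hK (c : K) (m : M) : p (c • m) = c • p m := by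
      have h₁ : algebraMap K (PathAlgebra K V) c = vertexHom K V fun _ => c := by
        rw [vertexHom_apply, ← Finset.smul_sum, sum_idem, Algebra.algebraMap_eq_smul_one]
      have h₂ : algebraMap K (PathAlgebra K V ⧸ I) c =
          Ideal.Quotient.mk I (vertexHom K V fun _ => c) := by
        rw [← h₁]
        rfl
      change p (algebraMap K (PathAlgebra K V ⧸ I) c • m) =
        algebraMap K (PathAlgebra K V ⧸ I) c • p m
      rw [h₂, hc]
    let P : M →ₗ[K] M := { p with map_smul' := hK }
    let N : Submodule (PathAlgebra K V ⧸ I) M :=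
      { carrier := {m | p m = 0}
        add_mem' := fun {x y} (hx : p x = 0) (hy : p y = 0) =>
          show p (x + y) = 0 by rw [map_add, hx, hy, add_zero]
        zero_mem' := map_zero p
        smul_mem' := fun a m (hm : p m = 0) =>
          show p (a • m) = 0 by rw [← hl, hm, smul_zero, map_zero] }
    have hsub (m : M) : m - p m ∈ N := by
      change p (m - p m) = 0
      rw [map_sub, hp, sub_self]
    -- The abstract datum `(M, p)` is a pair `ker p ⊆ M` with complement `im p`, so the required
    -- `B`-structure is that of `PairModule`.
    have h : IsVertexwiseCompl N (LinearMap.range P) :=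
      { isCompl := by
          refine IsCompl.of_le ?_ fun m _ => ?_
          · rintro _ ⟨hm, m, rfl⟩
            have h₁ : p (p m) = 0 := hm
            rw [hp] at h₁
            exact h₁
          · refine Submodule.mem_sup.2 ⟨m - p m, hsub m, p m, ⟨m, rfl⟩, sub_add_cancel _ _⟩
        idem_smul_mem := by
          classical
          rintro x _ ⟨m, rfl⟩
          -- The trivial path at `x` also comes from `S`, hence commutes with `p` and preserves its
          -- image.
          have h₁ : idem K x = vertexHom K V (Pi.single x 1) := by
            rw [vertexHom_apply, Finset.sum_eq_single x]
            · rw [Pi.single_eq_same, one_smul]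
            · intro y _ hy
              rw [Pi.single_eq_of_ne hy, zero_smul]
            · simp
          refine ⟨Ideal.Quotient.mk I (idem K x) • m, ?_⟩
          rw [h₁]
          exact hc _ m }
    refine ⟨(inferInstance : Module _ (PairModule h)), PairModule.ext_smul_one_smul h, fun m => ?_⟩
    refine (PairModule.levelIdem_smul h 1 m).trans ?_
    -- The projection onto `im p` kills `m - p m` and fixes `p m`, so it is `p` itself.
    have h₁ := (h.proj_one_eq_zero_iff _).2 (hsub m)
    rw [map_sub, sub_eq_zero] at h₁
    rw [h₁]
    exact h.proj_one_of_mem ⟨m, rfl⟩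

theorem proposition3 (K : Type u) [Field K] [IsAlgClosed K]
    (V : Type v) [Fintype V] [Quiver.{w} V] (hV : QuiverAcyclic V)
    (I : Ideal (PathAlgebra K V)) [I.IsTwoSided]
    (hI : I ≤ PathAlgebra.arrowIdeal K V ^ 2)
    (hdim : globalDimension (PathAlgebra K V ⧸ I) ≤ 2) :
    globalDimension (PathAlgebra K (ExtVertex V) ⧸ PathAlgebra.extIdeal I) ≤ 2 ∧
    ∀ (M : Type (max u v w)) [AddCommGroup M] [Module K M] [Module (PathAlgebra K V ⧸ I) M]
      [IsScalarTower K (PathAlgebra K V ⧸ I) M]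
      (N : Submodule (PathAlgebra K V ⧸ I) M) (C : Submodule K M)
      (h : IsVertexwiseCompl N C),
      Subsingleton (Abelian.Ext (ModuleCat.of (PathAlgebra K V ⧸ I) (M ⧸ N))
        (ModuleCat.of (PathAlgebra K V ⧸ I) (M ⧸ N)) 2) →
      Subsingleton (Abelian.Ext (ModuleCat.of (PathAlgebra K V ⧸ I) M)
        (ModuleCat.of (PathAlgebra K V ⧸ I) N) 2) →
      Subsingleton (Abelian.Ext
        (ModuleCat.of (PathAlgebra K (ExtVertex V) ⧸ PathAlgebra.extIdeal I) (PairModule h))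
        (ModuleCat.of (PathAlgebra K (ExtVertex V) ⧸ PathAlgebra.extIdeal I) (PairModule h)) 2) := by
  have hε := isLevelExtension_extIdeal I
  refine ⟨hε.globalDimension_le_two hdim, fun M _ _ _ _ N C h htop hbot => ?_⟩
  have := IsLevelExtension.isScalarTower_of_smul_one (PairModule.ext_smul_one_smul h)
  -- With `bot = N`, the two `Ext²` conditions over `A` in `subsingleton_ext_two` become the
  -- hypotheses on `M / N` and on `(M, N)`.
  have hN : hε.bot (PathAlgebra K V ⧸ I) (PairModule h) = N := by
    ext m
    rw [hε.mem_bot, PairModule.levelIdem_smul]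
    exact h.proj_one_eq_zero_iff m
  refine hε.subsingleton_ext_two (X := PairModule h) ?_ ?_
  · rw [hN]
    exact htop
  · rw [hN]
    exact hbot
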